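/- Theorem 4.5. Let $\sigma=\{\sigma_i\mid i\in I\}$ be a partition of the set of all primes and let $G$ be a finite group. Terminology. A finite group is a $\pi$-group, for a set $\pi$ of primes, if every prime dividing its order lies in $\pi$; it is $\sigma$-primary if it is a $\sigma_i$-group for some $i$, and $\sigma$-nilpotent if it is a direct product of $\sigma$-primary groups. The $\sigma$-nilpotent residual $G^{\mathfrak N_\sigma}$ is the intersection of all normal subgroups $N$ of $G$ with $G/N$ $\sigma$-nilpotent. A subgroup $A$ of $G$ is $\sigma$-subnormal in $G$ if there is a chain $A=A_0\le A_1\le\dots\le A_n=G$ such that, for each $i=1,\dots,n$, either $A_{i-1}\trianglelefteq A_i$ or $A_i/(A_{i-1})_{A_i}$ is $\sigma$-primary, where $(A_{i-1})_{A_i}$ is the largest normal subgroup of $A_i$ contained in $A_{i-1}$. A subgroup $A$ of $G$ is modular in $G$ if $\langle X,A\cap Z\rangle=\langle X,A\rangle\cap Z$ for all $X\le Z\le G$, and $\langle A,Y\cap Z\rangle=\langle A,Y\rangle\cap Z$ for all $Y,Z\le G$ with $A\le Z$. A subgroup is $\sigma$-quasinormal in $G$ if it is $\sigma$-subnormal and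 modular in $G$. The group $G$ is an $M\sigma T$-group if, whenever $H$ is $\sigma$-quasinormal in $K$ and $K$ is $\sigma$-quasinormal in $G$, $H$ is $\sigma$-quasinormal in $G$. For a group $D$, $O_{\sigma_i}(D)$ is the largest normal $\sigma_i$-subgroup of $D$. A subgroup of $G$ is a Hall subgroup if its order and index are coprime, and a Hall $\sigma_i$-subgroup if it is a $\sigma_i$-group whose index is divisible by no prime in $\sigma_i$. A power automorphism of a group is an automorphism mapping every subgroup onto itself. For subgroups $D$ and $M$ of $G$ consider the following conditions: (i) $G=D\rtimes M$ (that is, $D\trianglelefteq G$, $G=DM$ and $D\cap M=1$), where $D$ is an abelian Hall subgroup of $G$ of odd order, $M$ is $\sigma$-nilpotent and the lattice of all subgroups of $M$ is modular; (ii) every element of $G$ induces by conjugation a power automorphism on $D$; (iii) for every $i\in I$, $O_{\sigma_i}(D)$ has a normal complement in a Hall $\sigma_i$-subgroup of $G$. If $G$ is a soluble $M\sigma T$-group and $D=G^{\mathfrak N_\sigma}$, then there is a subgroup $M$ of $G$ such that (i), (ii) and (iii) hold for $D$ and $M$. Conversely, if (i), (ii) and (iii) hold for some subgroups $D$ and $M$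 of $G$, then $G$ is a soluble $M\sigma T$-group. -/

import Mathlib

namespace SigmaGroup

/-- `σ = {σ i | i ∈ ι}` is a partition of the set of all primes. -/
def IsPrimePartition {ι : Type*} (σ : ι → Set ℕ) : Prop :=
  (⋃ i, σ i) = {p : ℕ | p.Prime} ∧ ∀ i j, i ≠ j → σ i ∩ σ j = ∅

/-- `G` is a `π`-group: every prime divisor of its order lies in `π` (used for finite `G`). -/
def IsPiGroup (π : Set ℕ) (G : Type*) [Group G] : Prop :=
  ∀ p : ℕ, p.Prime → p ∣ Nat.card G → p ∈ π

/-- `H` is a Hall subgroup of `G`: its order and its index are coprime. -/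
def IsHallSubgroup {G : Type*} [Group G] (H : Subgroup G) : Prop :=
  (Nat.card H).Coprime H.index

/-- `H` is a Hall `π`-subgroup of `G`: it is a `π`-group and no prime in `π` divides its index. -/
def IsHallPiSubgroup {G : Type*} [Group G] (π : Set ℕ) (H : Subgroup G) : Prop :=
  IsPiGroup π H ∧ ∀ p : ℕ, p.Prime → p ∣ H.index → p ∉ π

/-- `O_π(G)`: the subgroup generated by all normal `π`-subgroups of `G`
(for finite `G` this is the largest normal `π`-subgroup). -/
def piCore (π : Set ℕ) (G : Type*) [Group G] : Subgroup G :=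
  sSup {N : Subgroup G | N.Normal ∧ IsPiGroup π N}

/-- `G` is `σ`-primary: it is a `σ i`-group for some `i`. -/
def IsSigmaPrimary {ι : Type*} (σ : ι → Set ℕ) (G : Type*) [Group G] : Prop :=
  ∃ i, IsPiGroup (σ i) G

/-- `G` is `σ`-nilpotent: it is the (internal) direct product of finitely many
`σ`-primary subgroups. -/
def IsSigmaNilpotent {ι : Type*} (σ : ι → Set ℕ) (G : Type*) [Group G] : Prop :=
  ∃ (n : ℕ) (K : Fin n → Subgroup G),
    (∀ j, (K j).Normal) ∧ (∀ j, IsSigmaPrimary σ (K j)) ∧ iSupIndep K ∧ ⨆ j, K j = ⊤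

/-- The `σ`-nilpotent residual of `G`: the intersection of all normal subgroups `N` such that
`G ⧸ N` is `σ`-nilpotent. -/
def sigmaResidual {ι : Type*} (σ : ι → Set ℕ) (G : Type*) [Group G] : Subgroup G :=
  sInf {N : Subgroup G | ∃ _ : N.Normal, IsSigmaNilpotent σ (G ⧸ N)}

/-- One link `A ≤ B` of a `σ`-subnormal chain: `A` is normal in `B`, or the quotient of `B` by
the core of `A` in `B` is `σ`-primary. -/
def SigmaSubnormalStep {ι : Type*} (σ : ι → Set ℕ) {G : Type*} [Group G]
    (A B : Subgroup G) : Prop :=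
  A ≤ B ∧ ((A.subgroupOf B).Normal ∨ IsSigmaPrimary σ (B ⧸ (A.subgroupOf B).normalCore))

/-- `A` is `σ`-subnormal in `G`: a finite chain of such links leads from `A` to `G`. -/
def IsSigmaSubnormal {ι : Type*} (σ : ι → Set ℕ) {G : Type*} [Group G]
    (A : Subgroup G) : Prop :=
  Relation.ReflTransGen (SigmaSubnormalStep σ) A ⊤

/-- `M` is modular in `G`: it is a modular element, in the sense of Kurosh, of the lattice of
all subgroups of `G`. -/
def IsModularSubgroup {G : Type*} [Group G] (M : Subgroup G) : Prop :=
  (∀ X Z : Subgroup G, X ≤ Z → X ⊔ (M ⊓ Z) = (X ⊔ M) ⊓ Z) ∧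
  (∀ Y Z : Subgroup G, M ≤ Z → M ⊔ (Y ⊓ Z) = (M ⊔ Y) ⊓ Z)

/-- `A` is `σ`-quasinormal in `G`: it is `σ`-subnormal and modular in `G`. -/
def IsSigmaQuasinormal {ι : Type*} (σ : ι → Set ℕ) {G : Type*} [Group G]
    (A : Subgroup G) : Prop :=
  IsSigmaSubnormal σ A ∧ IsModularSubgroup A

/-- `G` is an `MσT`-group: if `K` is `σ`-quasinormal in `G` and `H` is `σ`-quasinormal in `K`,
then `H` is `σ`-quasinormal in `G`. -/
def IsMSigmaTGroup {ι : Type*} (σ : ι → Set ℕ) (G : Type*) [Group G] : Prop :=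
  ∀ (K : Subgroup G) (H : Subgroup K),
    IsSigmaQuasinormal σ H → IsSigmaQuasinormal σ K → IsSigmaQuasinormal σ (H.map K.subtype)

/-- A power automorphism: an automorphism that maps every subgroup onto itself. -/
def IsPowerAutomorphism {D : Type*} [Group D] (φ : MulAut D) : Prop :=
  ∀ H : Subgroup D, H.map φ.toMonoidHom = H

/-- `A` has a normal complement in the subgroup `H` of `G` (where `A ≤ H`). -/
def HasNormalComplementIn {G : Type*} [Group G] (A H : Subgroup G) : Prop :=
  A ≤ H ∧ ∃ S : Subgroup H, S.Normal ∧ (A.subgroupOf H).IsComplement' S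

/-- The structural conditions on a pair `D`, `M` of subgroups of `G`. -/
structure StructureConditions {ι : Type*} (σ : ι → Set ℕ) {G : Type*} [Group G]
    (D M : Subgroup G) : Prop where
  /-- `G = D ⋊ M` -/
  normal : D.Normal
  compl : D.IsComplement' M
  abelian : IsMulCommutative D
  hall : IsHallSubgroup D
  odd : Odd (Nat.card D)
  nilpotent : IsSigmaNilpotent σ M
  modular : IsModularLattice (Subgroup M)
  /-- every element of `G` induces by conjugation a power automorphism on `D` -/
  power : ∀ g : G, IsPowerAutomorphism (MulAut.conjNormal g : MulAut D)
  /-- `O_{σ i}(D)` has a normal complement in a Hall `σ i`-subgroup of `G`, for every `i` -/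
  complement : ∀ i, ∃ H : Subgroup G, IsHallPiSubgroup (σ i) H ∧
    HasNormalComplementIn ((piCore (σ i) D).map D.subtype) H

end SigmaGroup

/-!
A finite group is `σ`-nilpotent exactly when its elements of prime power order commute whenever
their primes lie in different blocks of `σ`. Hence `σ`-nilpotency and `σ`-subnormality are
controlled by the subgroups generated by the `π`-elements of prime power order.

Sufficiency. Let `A` be `σ`-subnormal. By (ii) the subgroup `D ∩ A` is normal, and modulo it
`A` has order prime to that of `D` and centralizes `D`, as one sees by climbing a `σ`-subnormal
chain: steps inside a block are harmless by (iii). Modularity of `A` can then be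
tested modulo `D`, where the whole subgroup lattice is modular. So every `σ`-subnormal subgroup is
`σ`-quasinormal, and `σ`-subnormality is transitive. Solubility comes from that of groups with
modular subgroup lattice.

Necessity. Let `P` be a Sylow subgroup for the largest prime `p` dividing `|G|`, with `p ∈ σ i`.
It is normal, each of its subgroups is `σ`-quasinormal, and by the modular law every `p'`-element
of prime power order normalizes all subgroups of `P`. Argue by induction on `|G|`.

* If all `t`-elements with `t ∉ σ i` centralize `P`, then `D ∩ P = 1` and the claim passes from
  `G / P` to `G`.
* Otherwise some `t`-element `y` with `t ∉ σ i` acts nontrivially, so `P` is abelian, `p` is odd and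
  `P = [P, y] ≤ D`. If a `σ i`-element also acted nontrivially, then every nontrivial normal
  subgroup would contain `P` by induction; `P` would be self-centralizing of order `p`, and the
  modular law for a subgroup of prime order of a complement `Q` would force `|Q|` to be a
  prime in `σ i`, contrary to the choice of `y`. So `D` is the product of `P` and a normal subgroup
  isomorphic to the residual of `G / P`.
-/

namespace SigmaGroup

open scoped commutatorElement

/-! ### Elements of prime power order -/

section PElements

variable {G G' : Type*} [Group G] [Group G'] {p q : ℕ} {x y : G}

/-- `x` is a `p`-element: its order is a power of `p`. -/
def IsPElement (p : ℕ) (x : G) : Prop := ∃ k : ℕ, x ^ p ^ k = 1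

lemma IsPElement.map (hx : IsPElement p x) (f : G →* G') : IsPElement p (f x) :=
  hx.imp fun k hk => by rw [← map_pow, hk, map_one]

lemma isPElement_map_iff {f : G →* G'} (hf : Function.Injective f) :
    IsPElement p (f x) ↔ IsPElement p x :=
  exists_congr fun k => by rw [← map_pow, map_eq_one_iff f hf]

lemma isPElement_coe {H : Subgroup G} {x : H} : IsPElement p (x : G) ↔ IsPElement p x :=
  isPElement_map_iff H.subtype_injective

lemma IsPElement.zpow (hx : IsPElement p x) (n : ℤ) : IsPElement p (x ^ n) :=
  hx.imp fun k hk => by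
    rw [← zpow_natCast, ← zpow_mul, mul_comm, zpow_mul, zpow_natCast, hk, one_zpow]

lemma IsPElement.inv (hx : IsPElement p x) : IsPElement p x⁻¹ :=
  zpow_neg_one x ▸ hx.zpow (-1)

lemma IsPElement.conj (hx : IsPElement p x) (g : G) : IsPElement p (g * x * g⁻¹) :=
  hx.map (MulAut.conj g).toMonoidHom

lemma isPGroup_iff_forall_isPElement {H : Subgroup G} :
    IsPGroup p H ↔ ∀ x ∈ H, IsPElement p x :=
  ⟨fun h x hx => isPElement_coe.2 (h ⟨x, hx⟩), fun h x => isPElement_coe.1 (h x x.2)⟩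

lemma mem_of_pow_mem_of_coprime {H : Subgroup G} {m n : ℕ} (hmn : m.Coprime n)
    (hm : x ^ m ∈ H) (hn : x ^ n ∈ H) : x ∈ H := by
  have hbezout : (x ^ m) ^ m.gcdA n * (x ^ n) ^ m.gcdB n = x := by
    rw [← zpow_natCast, ← zpow_natCast, ← zpow_mul, ← zpow_mul, ← zpow_add,
      ← Nat.gcd_eq_gcd_ab, hmn.gcd_eq_one, Nat.cast_one, zpow_one]
  exact hbezout ▸ H.mul_mem (H.zpow_mem hm _) (H.zpow_mem hn _)

lemma eq_one_of_pow_eq_one_of_coprime {m n : ℕ} (hmn : m.Coprime n) (hm : x ^ m = 1)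
    (hn : x ^ n = 1) : x = 1 :=
  Subgroup.mem_bot.1 (mem_of_pow_mem_of_coprime hmn (Subgroup.mem_bot.2 hm) (Subgroup.mem_bot.2 hn))

lemma mem_of_mul_mem_of_coprime {H : Subgroup G} {m n : ℕ} (hmn : m.Coprime n)
    (hxy : Commute x y) (hx : x ^ m = 1) (hy : y ^ n = 1) (h : x * y ∈ H) : x ∈ H := by
  have hxn : x ^ n ∈ H := by simpa only [hxy.mul_pow, hy, mul_one] using H.pow_mem h n
  exact mem_of_pow_mem_of_coprime hmn (hx ▸ H.one_mem) hxn

lemma IsPElement.mem_of_pow_mem {H : Subgroup G} {m : ℕ} (hx : IsPElement p x)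
    (hm : m.Coprime p) (hxm : x ^ m ∈ H) : x ∈ H := by
  obtain ⟨k, hk⟩ := hx
  exact mem_of_pow_mem_of_coprime (hm.pow_right k) hxm (hk ▸ H.one_mem)

lemma IsPElement.eq_one_of_pow_eq_one {m : ℕ} (hx : IsPElement p x) (hm : m.Coprime p)
    (hxm : x ^ m = 1) : x = 1 :=
  Subgroup.mem_bot.1 (hx.mem_of_pow_mem hm (Subgroup.mem_bot.2 hxm))

lemma IsPElement.mem_of_not_dvd_index (hx : IsPElement p x) (hp : p.Prime) {N : Subgroup G}
    [N.Normal] (hN : ¬ p ∣ N.index) : x ∈ N :=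
  hx.mem_of_pow_mem (hp.coprime_iff_not_dvd.2 hN).symm (N.pow_index_mem x)

lemma pow_card_eq_one_of_mem {H : Subgroup G} (hx : x ∈ H) : x ^ Nat.card H = 1 :=
  congrArg Subtype.val (pow_card_eq_one' (x := (⟨x, hx⟩ : H)))

lemma IsPElement.eq_one_of_not_dvd_card (hx : IsPElement p x) (hp : p.Prime) {H : Subgroup G}
    (hxH : x ∈ H) (hH : ¬ p ∣ Nat.card H) : x = 1 :=
  hx.eq_one_of_pow_eq_one (hp.coprime_iff_not_dvd.2 hH).symm (pow_card_eq_one_of_mem hxH)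

lemma IsPElement.eq_one_of_ne (hp : p.Prime) (hq : q.Prime) (hpq : p ≠ q)
    (hxp : IsPElement p x) (hxq : IsPElement q x) : x = 1 := by
  obtain ⟨k, hk⟩ := hxq
  exact hxp.eq_one_of_pow_eq_one (((Nat.coprime_primes hq hp).2 hpq.symm).pow_left k) hk

lemma IsPElement.eq_one_of_mul {c : G} {n : ℕ} (hx : IsPElement p x)
    (hxc : IsPElement p (x * c)) (hcomm : Commute x c) (hn : n.Coprime p) (hc : c ^ n = 1) :
    c = 1 := by
  obtain ⟨k, hk⟩ := hx
  obtain ⟨l, hl⟩ := hxc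
  have hc' : c ^ p ^ (k + l) = 1 := by
    have h : (x * c) ^ p ^ (k + l) = 1 := by rw [add_comm, pow_add, pow_mul, hl, one_pow]
    rwa [hcomm.mul_pow, pow_add, pow_mul x, hk, one_pow, one_mul, ← pow_add] at h
  exact eq_one_of_pow_eq_one_of_coprime (hn.pow_right _) hc hc'

lemma le_of_forall_isPElement [Finite G] {H K : Subgroup G}
    (h : ∀ p : ℕ, p.Prime → ∀ x ∈ K, IsPElement p x → x ∈ H) : K ≤ H := by
  have key (n : ℕ) : 0 < n → ∀ x ∈ K, x ^ n = 1 → x ∈ H := by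
    induction n using Nat.recOnPrimeCoprime with
    | zero => exact fun h0 => absurd h0 (lt_irrefl _)
    | prime_pow p k hp => exact fun _ x hx hk => h p hp x hx ⟨k, hk⟩
    | coprime a b ha hb hab iha ihb =>
      intro _ x hx hxn
      exact mem_of_pow_mem_of_coprime hab
        (ihb (by lia) _ (K.pow_mem hx _) (by rw [← pow_mul, hxn]))
        (iha (by lia) _ (K.pow_mem hx _) (by rw [← pow_mul, mul_comm, hxn]))
  exact fun x hx => key (orderOf x) (orderOf_pos x) x hx (pow_orderOf_eq_one x)

lemma not_dvd_index_of_forall_isPElement [Finite G] (hp : p.Prime) {H : Subgroup G}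
    (h : ∀ x : G, IsPElement p x → x ∈ H) : ¬ p ∣ H.index := by
  have := Fact.mk hp
  obtain ⟨P⟩ : Nonempty (Sylow p G) := inferInstance
  have hPH : (P : Subgroup G) ≤ H := fun x hx =>
    h x (isPGroup_iff_forall_isPElement.1 P.isPGroup' x hx)
  exact fun hd => P.not_dvd_index (hd.trans (Subgroup.index_dvd_of_le hPH))

lemma IsPElement.exists_lift [Finite G] {f : G →* G'} (hf : Function.Surjective f)
    (hp : p.Prime) {y : G'} (hy : IsPElement p y) : ∃ x : G, IsPElement p x ∧ f x = y := by
  obtain ⟨x, rfl⟩ := hf y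
  obtain ⟨e, m, hm, hxm⟩ := Nat.exists_eq_pow_mul_and_not_dvd (orderOf_pos x).ne' p hp.ne_one
  have hfx : f x ∈ Subgroup.zpowers (f x ^ m) :=
    hy.mem_of_pow_mem (hp.coprime_iff_not_dvd.2 hm).symm (Subgroup.mem_zpowers _)
  obtain ⟨n, hn⟩ := Subgroup.mem_zpowers_iff.1 hfx
  refine ⟨(x ^ m) ^ n, IsPElement.zpow ⟨e, ?_⟩ n, by rw [map_zpow, map_pow, hn]⟩
  rw [← pow_mul, mul_comm, ← hxm, pow_orderOf_eq_one]

end PElements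

/-! ### Modular subgroups -/

section Modular

variable {G G' : Type*} [Group G] [Group G'] {f : G →* G'}

lemma isModularSubgroup_iff_le {A : Subgroup G} : IsModularSubgroup A ↔
    (∀ X Z : Subgroup G, X ≤ Z → (X ⊔ A) ⊓ Z ≤ X ⊔ (A ⊓ Z)) ∧
    (∀ Y Z : Subgroup G, A ≤ Z → (A ⊔ Y) ⊓ Z ≤ A ⊔ (Y ⊓ Z)) :=
  ⟨fun h => ⟨fun X Z hXZ => (h.1 X Z hXZ).ge, fun Y Z hAZ => (h.2 Y Z hAZ).ge⟩,
    fun h => ⟨fun X Z hXZ =>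
      (le_inf (sup_le_sup_left inf_le_left X) (sup_le hXZ inf_le_right)).antisymm (h.1 X Z hXZ),
    fun Y Z hAZ =>
      (le_inf (sup_le_sup_left inf_le_left A) (sup_le hAZ inf_le_right)).antisymm (h.2 Y Z hAZ)⟩⟩

lemma isModularSubgroup_of_normal (N : Subgroup G) [N.Normal] : IsModularSubgroup N := by
  refine isModularSubgroup_iff_le.2 ⟨fun X Z hXZ => ?_, fun Y Z hNZ => ?_⟩
  · rintro _ ⟨h, hZ⟩
    obtain ⟨a, ha, n, hn, rfl⟩ := Subgroup.mem_sup_of_normal_right.1 h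
    exact Subgroup.mul_mem_sup ha ⟨hn, (Z.mul_mem_cancel_left (hXZ ha)).1 hZ⟩
  · rintro _ ⟨h, hZ⟩
    obtain ⟨n, hn, y, hy, rfl⟩ := Subgroup.mem_sup_of_normal_left.1 h
    exact Subgroup.mul_mem_sup hn ⟨hy, (Z.mul_mem_cancel_left (hNZ hn)).1 hZ⟩

lemma IsModularSubgroup.of_map (hf : Function.Injective f) {A : Subgroup G}
    (h : IsModularSubgroup (A.map f)) : IsModularSubgroup A := by
  refine ⟨fun X Z hXZ => Subgroup.map_injective hf ?_, fun Y Z hAZ => Subgroup.map_injective hf ?_⟩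
  · simpa only [Subgroup.map_sup, Subgroup.map_inf_eq _ _ f hf] using
      h.1 (X.map f) (Z.map f) (Subgroup.map_mono hXZ)
  · simpa only [Subgroup.map_sup, Subgroup.map_inf_eq _ _ f hf] using
      h.2 (Y.map f) (Z.map f) (Subgroup.map_mono hAZ)

lemma IsModularSubgroup.of_comap (hf : Function.Surjective f) {A : Subgroup G'}
    (h : IsModularSubgroup (A.comap f)) : IsModularSubgroup A := by
  refine ⟨fun X Z hXZ => Subgroup.comap_injective hf ?_,
    fun Y Z hAZ => Subgroup.comap_injective hf ?_⟩
  · simpa only [← Subgroup.comap_sup_eq f _ _ hf, Subgroup.comap_inf] using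
      h.1 (X.comap f) (Z.comap f) (Subgroup.comap_mono hXZ)
  · simpa only [← Subgroup.comap_sup_eq f _ _ hf, Subgroup.comap_inf] using
      h.2 (Y.comap f) (Z.comap f) (Subgroup.comap_mono hAZ)

lemma map_comap_inf (f : G →* G') (A : Subgroup G') (Z : Subgroup G) :
    (A.comap f ⊓ Z).map f = A ⊓ Z.map f := by
  ext y
  constructor
  · rintro ⟨x, ⟨hxA, hxZ⟩, rfl⟩
    exact ⟨hxA, x, hxZ, rfl⟩
  · rintro ⟨hyA, x, hxZ, rfl⟩
    exact ⟨x, ⟨hyA, hxZ⟩, rfl⟩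

lemma map_inf_of_ker_le {Y Z : Subgroup G} (hZ : f.ker ≤ Z) :
    (Y ⊓ Z).map f = Y.map f ⊓ Z.map f := by
  rw [← Subgroup.comap_map_eq_self hZ, inf_comm, map_comap_inf, Subgroup.comap_map_eq_self hZ,
    inf_comm]

lemma IsModularSubgroup.comap (hf : Function.Surjective f) {A : Subgroup G'}
    (h : IsModularSubgroup A) : IsModularSubgroup (A.comap f) := by
  have hker : f.ker ≤ A.comap f := f.ker_le_comap A
  have hmap : (A.comap f).map f = A := Subgroup.map_comap_eq_self_of_surjective hf A
  refine isModularSubgroup_iff_le.2 ⟨fun X Z hXZ => ?_, fun Y Z hAZ => ?_⟩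
  · have hle : (X ⊔ A.comap f) ⊓ Z ≤ (X ⊔ (A.comap f ⊓ Z)) ⊔ f.ker := by
      rw [← Subgroup.map_le_map_iff, Subgroup.map_sup, map_comap_inf,
        h.1 _ _ (Subgroup.map_mono hXZ), ← hmap, ← Subgroup.map_sup, hmap]
      exact Subgroup.map_inf_le _ _ f
    calc (X ⊔ A.comap f) ⊓ Z ≤ ((X ⊔ (A.comap f ⊓ Z)) ⊔ f.ker) ⊓ Z := le_inf hle inf_le_right
      _ = (X ⊔ (A.comap f ⊓ Z)) ⊔ (f.ker ⊓ Z) :=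
        ((isModularSubgroup_of_normal f.ker).1 _ Z (sup_le hXZ inf_le_right)).symm
      _ ≤ X ⊔ (A.comap f ⊓ Z) := sup_le le_rfl (le_sup_of_le_right (inf_le_inf_right Z hker))
  · have hle : (A.comap f ⊔ Y) ⊓ Z ≤ (A.comap f ⊔ (Y ⊓ Z)) ⊔ f.ker := by
      rw [← Subgroup.map_le_map_iff, Subgroup.map_sup, map_inf_of_ker_le (hker.trans hAZ), hmap,
        Subgroup.map_sup, hmap, ← h.2 _ _ (hmap.ge.trans (Subgroup.map_mono hAZ)),
        map_inf_of_ker_le (hker.trans hAZ)]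
    exact hle.trans (sup_le le_rfl (hker.trans le_sup_left))

lemma isModularSubgroup_comap_iff (hf : Function.Surjective f) {A : Subgroup G'} :
    IsModularSubgroup (A.comap f) ↔ IsModularSubgroup A :=
  ⟨.of_comap hf, .comap hf⟩

lemma isModularLattice_iff_forall_isModularSubgroup :
    IsModularLattice (Subgroup G) ↔ ∀ A : Subgroup G, IsModularSubgroup A :=
  ⟨fun _ A => ⟨fun _ _ hXZ => (sup_inf_assoc_of_le A hXZ).symm,
    fun Y _ hAZ => (sup_inf_assoc_of_le Y hAZ).symm⟩,
    fun h => ⟨fun Y Z hXZ => ((h Y).1 _ Z hXZ).ge⟩⟩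

lemma isModularLattice_of_surjective (hG : IsModularLattice (Subgroup G))
    (hf : Function.Surjective f) : IsModularLattice (Subgroup G') := by
  rw [isModularLattice_iff_forall_isModularSubgroup] at hG ⊢
  exact fun A => .of_comap hf (hG _)

lemma isModularLattice_of_injective (hG' : IsModularLattice (Subgroup G'))
    (hf : Function.Injective f) : IsModularLattice (Subgroup G) := by
  rw [isModularLattice_iff_forall_isModularSubgroup] at hG' ⊢
  exact fun A => .of_map hf (hG' _)

lemma isModularSubgroup_sup_of_quotient {N : Subgroup G} [N.Normal]
    (h : IsModularLattice (Subgroup (G ⧸ N))) (A : Subgroup G) : IsModularSubgroup (A ⊔ N) := by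
  have := (isModularLattice_iff_forall_isModularSubgroup.1 h (A.map (QuotientGroup.mk' N))).comap
    (QuotientGroup.mk'_surjective N)
  rwa [Subgroup.comap_map_eq, QuotientGroup.ker_mk'] at this

end Modular

/-! ### The subgroup generated by the `π`-elements of prime power order -/

section PiClosure

variable {G G' : Type*} [Group G] [Group G'] {π π' : Set ℕ} {p : ℕ} {x : G} {A B : Subgroup G}

/-- The subgroup of `A` generated by its `p`-elements with `p ∈ π`. For finite `A` it is the
smallest normal subgroup of `A` whose index is not divisible by a prime in `π`,
usually written `O^{π'}(A)`. -/
def piClosure (π : Set ℕ) (A : Subgroup G) : Subgroup G :=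
  Subgroup.closure {x | x ∈ A ∧ ∃ p : ℕ, p.Prime ∧ p ∈ π ∧ IsPElement p x}

lemma piClosure_le_iff {H : Subgroup G} : piClosure π A ≤ H ↔
    ∀ p : ℕ, p.Prime → p ∈ π → ∀ x ∈ A, IsPElement p x → x ∈ H :=
  (Subgroup.closure_le _).trans
    ⟨fun h p hp hpπ _ hxA hx => h ⟨hxA, p, hp, hpπ, hx⟩,
      fun h _ ⟨hxA, p, hp, hpπ, hx⟩ => h p hp hpπ _ hxA hx⟩

lemma IsPElement.mem_piClosure (hx : IsPElement p x) (hp : p.Prime) (hpπ : p ∈ π)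
    (hxA : x ∈ A) : x ∈ piClosure π A :=
  Subgroup.subset_closure ⟨hxA, p, hp, hpπ, hx⟩

lemma piClosure_le : piClosure π A ≤ A :=
  piClosure_le_iff.2 fun _ _ _ _ hx _ => hx

lemma piClosure_mono (hπ : π ⊆ π') (hAB : A ≤ B) : piClosure π A ≤ piClosure π' B :=
  piClosure_le_iff.2 fun _ hp hpπ _ hxA hx => hx.mem_piClosure hp (hπ hpπ) (hAB hxA)

lemma piClosure_le_centralizer_iff :
    piClosure π A ≤ Subgroup.centralizer (piClosure π' B : Set G) ↔
      ∀ p q : ℕ, p.Prime → q.Prime → p ∈ π → q ∈ π' → ∀ x ∈ A, ∀ y ∈ B,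
        IsPElement p x → IsPElement q y → Commute x y := by
  refine piClosure_le_iff.trans
    ⟨fun h p q hp hq hpπ hqπ x hxA y hyB hx hy => ?_, fun h p hp hpπ x hxA hx => ?_⟩
  · exact (Subgroup.mem_centralizer_iff.1 (h p hp hpπ x hxA hx) y
      (hy.mem_piClosure hq hqπ hyB)).symm
  · rw [piClosure, Subgroup.centralizer_closure, Subgroup.mem_centralizer_iff]
    rintro y ⟨hyB, q, hq, hqπ, hy⟩
    exact (h p q hp hq hpπ hqπ x hxA y hyB hx hy).symm

lemma map_piClosure_le (f : G →* G') : (piClosure π A).map f ≤ piClosure π (A.map f) :=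
  Subgroup.map_le_iff_le_comap.2 <| piClosure_le_iff.2 fun _ hp hpπ x hxA hx =>
    (hx.map f).mem_piClosure hp hpπ ⟨x, hxA, rfl⟩

lemma map_piClosure [Finite G] (f : G →* G') :
    (piClosure π A).map f = piClosure π (A.map f) := by
  refine (map_piClosure_le f).antisymm (piClosure_le_iff.2 fun p hp hpπ y hyA hy => ?_)
  obtain ⟨x, hx, hxy⟩ := IsPElement.exists_lift (f.subgroupMap_surjective A) hp
    (y := ⟨y, hyA⟩) (isPElement_coe.1 hy)
  exact ⟨x, (isPElement_coe.2 hx).mem_piClosure hp hpπ x.2, congrArg Subtype.val hxy⟩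

lemma normalizer_le_normalizer_piClosure :
    Subgroup.normalizer (A : Set G) ≤ Subgroup.normalizer (piClosure π A : Set G) := by
  have hconj : ∀ g ∈ Subgroup.normalizer (A : Set G), ∀ n ∈ piClosure π A,
      g * n * g⁻¹ ∈ piClosure π A := fun g hg n hn =>
    (map_piClosure_le (MulAut.conj g).toMonoidHom).trans
      (piClosure_mono subset_rfl (Subgroup.map_le_iff_le_comap.2 fun a ha =>
        (Subgroup.mem_normalizer_iff.1 hg a).1 ha)) ⟨n, hn, rfl⟩
  refine fun g hg => Subgroup.mem_normalizer_iff.2 fun n => ⟨hconj g hg n, fun hn => ?_⟩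
  simpa [mul_assoc] using hconj g⁻¹ (inv_mem hg) _ hn

instance piClosure_normal [A.Normal] : (piClosure π A).Normal :=
  Subgroup.normalizer_eq_top_iff.1 <| top_le_iff.1 <|
    (Subgroup.normalizer_eq_top A).ge.trans normalizer_le_normalizer_piClosure

lemma isPiGroup_subgroup_iff [Finite G] :
    IsPiGroup π A ↔ ∀ q : ℕ, q.Prime → q ∉ π → ∀ x ∈ A, IsPElement q x → x = 1 := by
  refine ⟨fun h q hq hqπ x hx hxq => hxq.eq_one_of_not_dvd_card hq hx fun hd => hqπ (h q hq hd),
    fun h p hp hd => by_contra fun hpπ => ?_⟩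
  have := Fact.mk hp
  obtain ⟨x, hx⟩ := exists_prime_orderOf_dvd_card' p hd
  have hx1 : (x : G) = 1 :=
    h p hp hpπ x x.2 (isPElement_coe.2 ⟨1, by rw [pow_one, ← hx, pow_orderOf_eq_one]⟩)
  rw [OneMemClass.coe_eq_one.1 hx1, orderOf_one] at hx
  exact hp.ne_one hx.symm

lemma isPiGroup_quotient_iff [Finite G] {N : Subgroup G} [N.Normal] :
    IsPiGroup π (G ⧸ N) ↔ piClosure πᶜ ⊤ ≤ N := by
  rw [piClosure_le_iff]
  exact ⟨fun h q hq hqπ x _ hx => hx.mem_of_not_dvd_index hq fun hd => hqπ (h q hq hd),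
    fun h p hp hd => by_contra fun hpπ =>
      not_dvd_index_of_forall_isPElement hp (fun x hx => h p hp hpπ x trivial hx) hd⟩

end PiClosure

/-! ### `σ`-subnormal and `σ`-quasinormal subgroups -/

section Subnormal

variable {ι G G' : Type*} {σ : ι → Set ℕ} [Group G] [Group G'] {f : G →* G'}

lemma sigmaSubnormalStep_iff [Finite G] {A B : Subgroup G} : SigmaSubnormalStep σ A B ↔
    A ≤ B ∧ (B ≤ Subgroup.normalizer A ∨ ∃ i, piClosure (σ i)ᶜ B ≤ A) := by
  refine and_congr_right fun hAB => or_congr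
    (Subgroup.normal_subgroupOf_iff_le_normalizer hAB) (exists_congr fun i => ?_)
  rw [isPiGroup_quotient_iff, Subgroup.normal_le_normalCore, Subgroup.subgroupOf,
    ← Subgroup.map_le_iff_le_comap, map_piClosure, ← MonoidHom.range_eq_map, Subgroup.range_subtype]

lemma SigmaSubnormalStep.comap [Finite G] [Finite G'] (f : G →* G') {A B : Subgroup G'}
    (h : SigmaSubnormalStep σ A B) : SigmaSubnormalStep σ (A.comap f) (B.comap f) := by
  rw [sigmaSubnormalStep_iff] at h ⊢
  refine ⟨Subgroup.comap_mono h.1, h.2.imp (fun h => ?_) (Exists.imp fun i h => ?_)⟩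
  · exact (Subgroup.comap_mono h).trans (Subgroup.le_normalizer_comap f)
  · exact Subgroup.map_le_iff_le_comap.1 <| (map_piClosure_le f).trans <|
      (piClosure_mono subset_rfl (Subgroup.map_comap_le f B)).trans h

lemma SigmaSubnormalStep.map [Finite G] [Finite G'] (f : G →* G') {A B : Subgroup G}
    (h : SigmaSubnormalStep σ A B) : SigmaSubnormalStep σ (A.map f) (B.map f) := by
  rw [sigmaSubnormalStep_iff] at h ⊢
  refine ⟨Subgroup.map_mono h.1, h.2.imp (fun h => ?_) (Exists.imp fun i h => ?_)⟩
  · exact (Subgroup.map_mono h).trans (Subgroup.le_normalizer_map f)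
  · exact (map_piClosure f).ge.trans (Subgroup.map_mono h)

lemma IsSigmaSubnormal.comap [Finite G] [Finite G'] (f : G →* G') {A : Subgroup G'}
    (h : IsSigmaSubnormal σ A) : IsSigmaSubnormal σ (A.comap f) := by
  have := Relation.ReflTransGen.lift (p := SigmaSubnormalStep σ) (Subgroup.comap f)
    (fun _ _ hs => hs.comap f) _ _ h
  rwa [Function.onFun, Subgroup.comap_top] at this

lemma isSigmaSubnormal_comap_iff [Finite G] [Finite G'] (hf : Function.Surjective f)
    {A : Subgroup G'} : IsSigmaSubnormal σ (A.comap f) ↔ IsSigmaSubnormal σ A := by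
  refine ⟨fun h => ?_, fun h => h.comap f⟩
  have := Relation.ReflTransGen.lift (p := SigmaSubnormalStep σ) (Subgroup.map f)
    (fun _ _ hs => hs.map f) _ _ h
  rwa [Function.onFun, Subgroup.map_comap_eq_self_of_surjective hf,
    Subgroup.map_top_of_surjective f hf] at this

lemma IsSigmaSubnormal.trans [Finite G] {K : Subgroup G} {H : Subgroup K}
    (hH : IsSigmaSubnormal σ H) (hK : IsSigmaSubnormal σ K) :
    IsSigmaSubnormal σ (H.map K.subtype) := by
  have := Relation.ReflTransGen.lift (p := SigmaSubnormalStep σ) (Subgroup.map K.subtype)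
    (fun _ _ hs => hs.map K.subtype) _ _ hH
  rw [Function.onFun, ← MonoidHom.range_eq_map, Subgroup.range_subtype] at this
  exact Relation.ReflTransGen.trans this hK

lemma isSigmaQuasinormal_comap_iff [Finite G] [Finite G'] (hf : Function.Surjective f)
    {A : Subgroup G'} : IsSigmaQuasinormal σ (A.comap f) ↔ IsSigmaQuasinormal σ A :=
  and_congr (isSigmaSubnormal_comap_iff hf) (isModularSubgroup_comap_iff hf)

lemma isSigmaQuasinormal_of_normal (N : Subgroup G) [hN : N.Normal] : IsSigmaQuasinormal σ N :=
  ⟨Relation.ReflTransGen.single ⟨le_top, Or.inl (hN.subgroupOf ⊤)⟩, isModularSubgroup_of_normal N⟩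

lemma map_comap_subgroupComap (f : G →* G') (K : Subgroup G') (H : Subgroup K) :
    (H.comap (f.subgroupComap K)).map (K.comap f).subtype = (H.map K.subtype).comap f := by
  ext x
  constructor
  · rintro ⟨y, hy, rfl⟩
    exact ⟨f.subgroupComap K y, hy, rfl⟩
  · rintro ⟨⟨y, hyK⟩, hy, hyx⟩
    obtain rfl : y = f x := hyx
    exact ⟨⟨x, hyK⟩, hy, rfl⟩

lemma IsMSigmaTGroup.of_surjective [Finite G] [Finite G'] (h : IsMSigmaTGroup σ G)
    (hf : Function.Surjective f) : IsMSigmaTGroup σ G' := by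
  intro K H hH hK
  have hfK := f.subgroupComap_surjective_of_surjective K hf
  rw [← isSigmaQuasinormal_comap_iff hf, ← map_comap_subgroupComap]
  exact h _ _ ((isSigmaQuasinormal_comap_iff hfK).2 hH) ((isSigmaQuasinormal_comap_iff hf).2 hK)

lemma IsMSigmaTGroup.trans (h : IsMSigmaTGroup σ G) {A B : Subgroup G} (hAB : A ≤ B)
    (hA : IsSigmaQuasinormal σ (A.subgroupOf B)) (hB : IsSigmaQuasinormal σ B) :
    IsSigmaQuasinormal σ A :=
  Subgroup.map_subgroupOf_eq_of_le hAB ▸ h B _ hA hB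

end Subnormal

/-! ### `σ`-nilpotent groups and the `σ`-nilpotent residual -/

section Nilpotent

variable {ι G G' : Type*} {σ : ι → Set ℕ} {π π' : Set ℕ} [Group G] [Group G'] {p q : ℕ} {i : ι}
  {x y : G}

lemma IsPrimePartition.exists_mem (hσ : IsPrimePartition σ) (hp : p.Prime) : ∃ i, p ∈ σ i :=
  Set.mem_iUnion.1 (hσ.1.ge hp)

lemma IsPrimePartition.disjoint (hσ : IsPrimePartition σ) {i j : ι} (hij : i ≠ j) :
    Disjoint (σ i) (σ j) :=
  Set.disjoint_iff_inter_eq_empty.2 (hσ.2 i j hij)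

lemma IsPrimePartition.eq_of_mem (hσ : IsPrimePartition σ) {i j : ι} (hi : p ∈ σ i)
    (hj : p ∈ σ j) : i = j :=
  by_contra fun hij => Set.disjoint_left.1 (hσ.disjoint hij) hi hj

lemma IsPiGroup.mono (hG : IsPiGroup π G) (h : π ⊆ π') : IsPiGroup π' G :=
  fun p hp hd => h (hG p hp hd)

lemma IsPiGroup.disjoint_of_compl {H K : Subgroup G} (hH : IsPiGroup π H)
    (hK : IsPiGroup πᶜ K) : Disjoint H K :=
  Subgroup.disjoint_of_coprime_natCard <|
    Nat.coprime_of_dvd fun p hp hpH hpK => hK p hp hpK (hH p hp hpH)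

lemma IsPElement.mem_of_sup_eq_top (hx : IsPElement p x) (hp : p.Prime) {A B : Subgroup G}
    [A.Normal] (h : A ⊔ B = ⊤) (hB : ¬ p ∣ Nat.card B) : x ∈ A := by
  refine hx.mem_of_not_dvd_index hp fun hd => hB ?_
  rw [← Subgroup.relIndex_top_right, ← h, sup_comm, Subgroup.relIndex_sup_right] at hd
  exact hd.trans (Subgroup.index_dvd_card _)

lemma isPiGroup_iSup {κ : Type*} [Finite κ] {K : κ → Subgroup G}
    (hcomm : Pairwise fun i j => ∀ x y : G, x ∈ K i → y ∈ K j → Commute x y)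
    (hK : ∀ k, IsPiGroup π (K k)) : IsPiGroup π (⨆ k, K k : Subgroup G) := by
  intro p hp hd
  have := Fintype.ofFinite κ
  rw [← Subgroup.noncommPiCoprod_range (hcomm := hcomm)] at hd
  have hprod := hd.trans (Subgroup.card_range_dvd _)
  rw [Nat.card_pi] at hprod
  obtain ⟨k, -, hk⟩ := hp.prime.exists_mem_finset_dvd hprod
  exact hK k p hp hk

lemma exists_normal_isComplement'_of_le_center [Finite G] [Fact p.Prime] (P : Sylow p G)
    (hP : (P : Subgroup G) ≤ Subgroup.center G) :
    ∃ K : Subgroup G, K.Normal ∧ K.IsComplement' P :=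
  ⟨_, inferInstance, MonoidHom.ker_transferSylow_isComplement' P fun g _ _ hy =>
    (Subgroup.mem_center_iff.1 (hP hy) g).symm⟩

-- By Burnside's transfer theorem a central Sylow `q`-subgroup, `q ∉ π`, has a normal complement,
-- which contains all generators.
lemma isPiGroup_piClosure [Finite G] {A : Subgroup G}
    (h : piClosure π A ≤ Subgroup.centralizer (piClosure πᶜ A : Set G)) :
    IsPiGroup π (piClosure π A) := by
  intro q hq hd
  by_contra hqπ
  have := Fact.mk hq
  obtain ⟨Q⟩ : Nonempty (Sylow q (piClosure π A)) := inferInstance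
  have hQ : (Q : Subgroup (piClosure π A)) ≤ Subgroup.center _ := fun y hy =>
    Subgroup.mem_center_iff.2 fun g => Subtype.ext <| .symm <|
      Subgroup.mem_centralizer_iff.1 (h g.2) y <|
        (isPElement_coe.2 (isPGroup_iff_forall_isPElement.1 Q.isPGroup' y hy)).mem_piClosure hq hqπ
          (piClosure_le y.2)
  obtain ⟨K, hK, hKQ⟩ := exists_normal_isComplement'_of_le_center Q hQ
  have hle : piClosure π A ≤ K.map (piClosure π A).subtype :=
    piClosure_le_iff.2 fun p hp hpπ x hxA hx => by
      have hxπ := hx.mem_piClosure hp hpπ hxA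
      refine ⟨⟨x, hxπ⟩,
        IsPElement.mem_of_sup_eq_top (isPElement_coe.1 hx) hp hKQ.sup_eq_top ?_, rfl⟩
      obtain ⟨n, hn⟩ := IsPGroup.iff_card.1 Q.isPGroup'
      rw [hn]
      exact fun hpq => hqπ ((Nat.prime_dvd_prime_iff_eq hp hq).1 (hp.dvd_of_dvd_pow hpq) ▸ hpπ)
  have hKtop : K = ⊤ := top_unique fun y _ => by
    obtain ⟨z, hz, hzy⟩ := hle y.2
    exact Subtype.ext hzy ▸ hz
  refine Q.not_dvd_index ?_
  rw [hKtop] at hKQ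
  rwa [top_disjoint.1 hKQ.disjoint, Subgroup.index_bot]

/-- Elements of prime power orders that belong to different blocks of `σ` commute. For finite
groups this is `σ`-nilpotency, see `isSigmaNilpotent_iff`. -/
def SigmaCommuting (σ : ι → Set ℕ) (G : Type*) [Group G] : Prop :=
  ∀ i, ∀ p q : ℕ, p.Prime → q.Prime → p ∈ σ i → q ∉ σ i →
    ∀ x y : G, IsPElement p x → IsPElement q y → Commute x y

lemma SigmaCommuting.of_injective (h : SigmaCommuting σ G') {f : G →* G'}
    (hf : Function.Injective f) : SigmaCommuting σ G :=
  fun i p q hp hq hpi hqi x y hx hy => hf <| by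
    rw [map_mul, map_mul, (h i p q hp hq hpi hqi _ _ (hx.map f) (hy.map f)).eq]

lemma SigmaCommuting.le_centralizer (h : SigmaCommuting σ G) (i : ι) :
    piClosure (σ i) (⊤ : Subgroup G) ≤
      Subgroup.centralizer (piClosure (σ i)ᶜ (⊤ : Subgroup G) : Set G) :=
  piClosure_le_centralizer_iff.2 fun p q hp hq hpi hqi x _ y _ => h i p q hp hq hpi hqi x y

lemma SigmaCommuting.isPiGroup_piClosure [Finite G] (h : SigmaCommuting σ G) (i : ι) :
    IsPiGroup (σ i) (piClosure (σ i) (⊤ : Subgroup G)) :=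
  SigmaGroup.isPiGroup_piClosure (h.le_centralizer i)

lemma SigmaCommuting.disjoint [Finite G] (h : SigmaCommuting σ G) (i : ι) :
    Disjoint (piClosure (σ i) (⊤ : Subgroup G)) (piClosure (σ i)ᶜ (⊤ : Subgroup G)) := by
  refine (h.isPiGroup_piClosure i).disjoint_of_compl (SigmaGroup.isPiGroup_piClosure ?_)
  rw [compl_compl, Subgroup.le_centralizer_iff]
  exact h.le_centralizer i

lemma SigmaCommuting.iSupIndep [Finite G] (hσ : IsPrimePartition σ) (h : SigmaCommuting σ G) :
    iSupIndep fun i => piClosure (σ i) (⊤ : Subgroup G) :=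
  fun i => (h.disjoint i).mono_right <| iSup₂_le fun _ hji =>
    piClosure_mono (hσ.disjoint hji).subset_compl_right le_rfl

lemma IsPrimePartition.finite_blocks (hσ : IsPrimePartition σ) (S : Finset ℕ) :
    {i | ∃ p ∈ S, p ∈ σ i}.Finite := by
  have hS : {i | ∃ p ∈ S, p ∈ σ i} = ⋃ p ∈ S, {i | p ∈ σ i} := by
    ext; simp only [Set.mem_ofPred_eq, Set.mem_iUnion, exists_prop]
  rw [hS]
  exact S.finite_toSet.biUnion fun p _ =>
    Set.Subsingleton.finite fun i hi j hj => hσ.eq_of_mem hi hj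

lemma SigmaCommuting.isSigmaNilpotent [Finite G] (hσ : IsPrimePartition σ)
    (h : SigmaCommuting σ G) : IsSigmaNilpotent σ G := by
  have := (hσ.finite_blocks (Nat.card G).primeFactors).to_subtype
  obtain ⟨n, ⟨e⟩⟩ := Finite.exists_equiv_fin {i | ∃ p ∈ (Nat.card G).primeFactors, p ∈ σ i}
  refine ⟨n, fun k => piClosure (σ (e.symm k)) ⊤, fun k => inferInstance,
    fun k => ⟨_, h.isPiGroup_piClosure _⟩,
    (h.iSupIndep hσ).comp (Subtype.val_injective.comp e.symm.injective), top_unique ?_⟩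
  refine le_of_forall_isPElement fun p hp x _ hx => ?_
  by_cases hd : p ∣ Nat.card G
  · obtain ⟨i, hi⟩ := hσ.exists_mem hp
    let j : {i | ∃ p ∈ (Nat.card G).primeFactors, p ∈ σ i} :=
      ⟨i, p, Nat.mem_primeFactors.2 ⟨hp, hd, Nat.card_pos.ne'⟩, hi⟩
    refine le_iSup (fun k => piClosure (σ (e.symm k)) (⊤ : Subgroup G)) (e j) ?_
    simp only [Equiv.symm_apply_apply]
    exact hx.mem_piClosure hp hi trivial
  · rw [hx.eq_one_of_not_dvd_card hp (Subgroup.mem_top x) (by rwa [Subgroup.card_top])]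
    exact Subgroup.one_mem _

lemma IsSigmaNilpotent.sigmaCommuting (hσ : IsPrimePartition σ)
    (h : IsSigmaNilpotent σ G) : SigmaCommuting σ G := by
  obtain ⟨n, K, hN, hprim, hind, hsup⟩ := h
  choose b hb using hprim
  intro i p q hp hq hpi hqi x y hx hy
  have hcomm : Pairwise fun j k => ∀ x y : G, x ∈ K j → y ∈ K k → Commute x y := fun j k hjk =>
    Subgroup.commute_of_normal_of_disjoint _ _ (hN j) (hN k) (hind.pairwiseDisjoint hjk)
  let A : Subgroup G := ⨆ j : {j // b j = i}, K j
  let B : Subgroup G := ⨆ j : {j // b j ≠ i}, K j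
  have hAn : A.Normal := Subgroup.iSup_normal fun j : {j // b j = i} => K j
  have hBn : B.Normal := Subgroup.iSup_normal fun j : {j // b j ≠ i} => K j
  have hAB : A ⊔ B = ⊤ := by
    rw [← hsup, iSup_split K fun j => b j = i, iSup_subtype', iSup_subtype']
  have hA : IsPiGroup (σ i) A := isPiGroup_iSup
    (fun j k hjk => hcomm (Subtype.coe_ne_coe.2 hjk)) fun j =>
      (hb j).mono (congrArg σ j.2).subset
  have hB : IsPiGroup (σ i)ᶜ B := isPiGroup_iSup
    (fun j k hjk => hcomm (Subtype.coe_ne_coe.2 hjk)) fun j =>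
      (hb j).mono (hσ.disjoint j.2).subset_compl_right
  have hxA : x ∈ A := hx.mem_of_sup_eq_top hp hAB fun hd => hB p hp hd hpi
  have hyB : y ∈ B := hy.mem_of_sup_eq_top hq ((sup_comm B A).trans hAB) fun hd => hqi (hA q hq hd)
  exact Subgroup.commute_of_normal_of_disjoint A B hAn hBn (hA.disjoint_of_compl hB) x y hxA hyB

lemma isSigmaNilpotent_iff [Finite G] (hσ : IsPrimePartition σ) :
    IsSigmaNilpotent σ G ↔ SigmaCommuting σ G :=
  ⟨IsSigmaNilpotent.sigmaCommuting hσ, SigmaCommuting.isSigmaNilpotent hσ⟩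

lemma isSigmaNilpotent_quotient_iff [Finite G] (hσ : IsPrimePartition σ) (N : Subgroup G)
    [N.Normal] : IsSigmaNilpotent σ (G ⧸ N) ↔
      ∀ i, ∀ p q : ℕ, p.Prime → q.Prime → p ∈ σ i → q ∉ σ i →
        ∀ x y : G, IsPElement p x → IsPElement q y → ⁅x, y⁆ ∈ N := by
  have hmk (x y : G) : Commute (QuotientGroup.mk' N x) (QuotientGroup.mk' N y) ↔ ⁅x, y⁆ ∈ N := by
    rw [← commutatorElement_eq_one_iff_commute, ← map_commutatorElement, ← MonoidHom.mem_ker,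
      QuotientGroup.ker_mk']
  have hsurj := QuotientGroup.mk'_surjective N
  rw [isSigmaNilpotent_iff hσ]
  constructor
  · intro h i p q hp hq hpi hqi x y hx hy
    exact (hmk x y).1 (h i p q hp hq hpi hqi _ _ (hx.map _) (hy.map _))
  · intro h i p q hp hq hpi hqi x' y' hx' hy'
    obtain ⟨x, hx, rfl⟩ := hx'.exists_lift hsurj hp
    obtain ⟨y, hy, rfl⟩ := hy'.exists_lift hsurj hq
    exact (hmk x y).2 (h i p q hp hq hpi hqi x y hx hy)

lemma sigmaResidual_le (N : Subgroup G) [hN : N.Normal] (h : IsSigmaNilpotent σ (G ⧸ N)) :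
    sigmaResidual σ G ≤ N :=
  sInf_le ⟨hN, h⟩

instance sigmaResidual_normal : (sigmaResidual σ G).Normal :=
  ⟨fun n hn g => Subgroup.mem_sInf.2 fun N hN =>
    hN.1.conj_mem n (Subgroup.mem_sInf.1 hn N hN) g⟩

lemma commutatorElement_mem_sigmaResidual [Finite G] (hσ : IsPrimePartition σ)
    (hp : p.Prime) (hq : q.Prime) (hpi : p ∈ σ i) (hqi : q ∉ σ i)
    (hx : IsPElement p x) (hy : IsPElement q y) : ⁅x, y⁆ ∈ sigmaResidual σ G :=
  Subgroup.mem_sInf.2 fun N ⟨_, h⟩ =>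
    (isSigmaNilpotent_quotient_iff hσ N).1 h i p q hp hq hpi hqi x y hx hy

lemma isSigmaNilpotent_quotient_sigmaResidual [Finite G] (hσ : IsPrimePartition σ) :
    IsSigmaNilpotent σ (G ⧸ sigmaResidual σ G) :=
  (isSigmaNilpotent_quotient_iff hσ _).2 fun _ _ _ hp hq hpi hqi _ _ hx hy =>
    commutatorElement_mem_sigmaResidual hσ hp hq hpi hqi hx hy

lemma map_sigmaResidual [Finite G] [Finite G'] (hσ : IsPrimePartition σ) {f : G →* G'}
    (hf : Function.Surjective f) : (sigmaResidual σ G).map f = sigmaResidual σ G' := by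
  apply le_antisymm
  · rw [Subgroup.map_le_iff_le_comap]
    refine sigmaResidual_le _ ((isSigmaNilpotent_quotient_iff hσ _).2 ?_)
    intro i p q hp hq hpi hqi x y hx hy
    rw [Subgroup.mem_comap, map_commutatorElement]
    exact commutatorElement_mem_sigmaResidual hσ hp hq hpi hqi (hx.map f) (hy.map f)
  · have := (sigmaResidual_normal (σ := σ) (G := G)).map f hf
    refine sigmaResidual_le _ ((isSigmaNilpotent_quotient_iff hσ _).2 ?_)
    intro i p q hp hq hpi hqi x' y' hx' hy'
    obtain ⟨x, hx, rfl⟩ := hx'.exists_lift hf hp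
    obtain ⟨y, hy, rfl⟩ := hy'.exists_lift hf hq
    exact ⟨_, commutatorElement_mem_sigmaResidual hσ hp hq hpi hqi hx hy,
      map_commutatorElement f x y⟩

lemma SigmaCommuting.exists_lt_sigmaSubnormalStep [Finite G] (hσ : IsPrimePartition σ)
    (h : SigmaCommuting σ G) {A : Subgroup G} (hA : A ≠ ⊤) :
    ∃ B, A < B ∧ SigmaSubnormalStep σ A B := by
  obtain ⟨p, hp, x, hx, hxA⟩ : ∃ p : ℕ, p.Prime ∧ ∃ x : G, IsPElement p x ∧ x ∉ A := by
    by_contra! hc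
    exact hA (top_unique (le_of_forall_isPElement fun p hp x _ hx => hc p hp x hx))
  obtain ⟨i, hi⟩ := hσ.exists_mem hp
  set C := piClosure (σ i) (⊤ : Subgroup G)
  have hAC : A ≤ piClosure (σ i)ᶜ A ⊔ C := le_of_forall_isPElement fun q hq y hyA hy => by
    by_cases hqi : q ∈ σ i
    · exact Subgroup.mem_sup_right (hy.mem_piClosure hq hqi trivial)
    · exact Subgroup.mem_sup_left (hy.mem_piClosure hq hqi hyA)
  refine ⟨A ⊔ C, lt_of_le_not_ge le_sup_left fun hle =>
    hxA (hle (Subgroup.mem_sup_right (hx.mem_piClosure hp hi trivial))), ?_⟩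
  refine sigmaSubnormalStep_iff.2 ⟨le_sup_left, Or.inr ⟨i, piClosure_le_iff.2 ?_⟩⟩
  intro q hq hqi y hyAC hy
  obtain ⟨n, hn, c, hc, rfl⟩ := Subgroup.mem_sup_of_normal_right.1 ((sup_le hAC le_sup_right) hyAC)
  have hc1 : c = 1 := Subgroup.disjoint_def.1 (h.disjoint i) hc <|
    (Subgroup.mul_mem_cancel_left _ (piClosure_mono subset_rfl le_top hn)).1
      (hy.mem_piClosure hq hqi trivial)
  rw [hc1, mul_one]
  exact piClosure_le hn

lemma SigmaCommuting.isSigmaSubnormal [Finite G] (hσ : IsPrimePartition σ)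
    (h : SigmaCommuting σ G) (A : Subgroup G) : IsSigmaSubnormal σ A := by
  induction A using WellFoundedGT.induction with
  | ind A ih =>
    obtain rfl | hA := eq_or_ne A ⊤
    · exact Relation.ReflTransGen.refl
    · obtain ⟨B, hAB, hstep⟩ := h.exists_lt_sigmaSubnormalStep hσ hA
      exact Relation.ReflTransGen.head hstep (ih B hAB)

end Nilpotent

/-! ### Finite groups with modular subgroup lattice are soluble -/

section ModularLattice

variable {G : Type*} [Group G] {p : ℕ} {x y : G} {A B : Subgroup G}

lemma card_zpowers_of_prime (hp : p.Prime) (hx : x ^ p = 1) (hx1 : x ≠ 1) :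
    Nat.card (Subgroup.zpowers x) = p := by
  have := Fact.mk hp
  rw [Nat.card_zpowers, orderOf_eq_prime hx hx1]

lemma isAtom_iff_card_prime [Finite G] : IsAtom A ↔ (Nat.card A).Prime := by
  refine ⟨fun h => ?_, fun h => ⟨?_, fun B hBA => ?_⟩⟩
  · obtain ⟨q, hq, hqd⟩ := Nat.exists_prime_and_dvd (mt Subgroup.card_eq_one.1 h.1)
    have := Fact.mk hq
    obtain ⟨z, hz⟩ := exists_prime_orderOf_dvd_card' q hqd
    have hz0 : Subgroup.zpowers (z : G) ≠ ⊥ := by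
      rw [Ne, Subgroup.zpowers_eq_bot, ← orderOf_eq_one_iff, Subgroup.orderOf_coe, hz]
      exact hq.ne_one
    rw [← (h.le_iff_eq hz0).1 (Subgroup.zpowers_le.2 z.2), Nat.card_zpowers, Subgroup.orderOf_coe,
      hz]
    exact hq
  · rintro rfl
    exact h.ne_one Subgroup.card_bot
  · have hne : Nat.card B ≠ Nat.card A := fun he =>
      hBA.ne (Subgroup.eq_of_le_of_card_ge hBA.le he.ge)
    exact Subgroup.card_eq_one.1 <|
      ((Nat.dvd_prime h).1 (Subgroup.card_dvd_of_le hBA.le)).resolve_right hne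

lemma not_dvd_index_of_normalizer_eq [Finite G] (hp : p.Prime) (hA : Nat.card A = p)
    (hN : Subgroup.normalizer (A : Set G) = A) : ¬ p ∣ A.index := by
  have := Fact.mk hp
  intro hd
  have hsq : p ^ (1 + 1) ∣ Nat.card G := by
    rw [← A.card_mul_index, hA, pow_succ, pow_one]
    exact mul_dvd_mul_left p hd
  have hle := Sylow.prime_pow_dvd_card_normalizer hsq (H := A) (by rw [hA, pow_one])
  rw [hN, hA] at hle
  exact absurd (Nat.le_of_dvd hp.pos hle) (not_le.2 (lt_self_pow₀ hp.one_lt (by norm_num)))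

lemma exists_normal_isComplement'_of_normalizer_eq [Finite G] (hp : p.Prime) (hA : Nat.card A = p)
    (hN : Subgroup.normalizer (A : Set G) = A) :
    ∃ N : Subgroup G, N.Normal ∧ N.IsComplement' A ∧ Nat.card N ≡ 1 [MOD p] := by
  have := Fact.mk hp
  have hpA : IsPGroup p A := .of_card (n := 1) (by rw [hA, pow_one])
  let P : Sylow p G := hpA.toSylow (not_dvd_index_of_normalizer_eq hp hA hN)
  have hPN : Subgroup.normalizer (P : Set G) = A := hN
  have hcyc : IsCyclic A := isCyclic_of_prime_card hA
  have hcomm : Subgroup.normalizer (P : Set G) ≤ Subgroup.centralizer (P : Set G) :=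
    hPN.le.trans (Subgroup.le_centralizer_iff_isMulCommutative.2 inferInstance)
  have hcompl : (MonoidHom.transferSylow P hcomm).ker.IsComplement' A :=
    MonoidHom.ker_transferSylow_isComplement' P hcomm
  refine ⟨_, inferInstance, hcompl, ?_⟩
  rw [← hcompl.index_eq_card, ← hPN, ← P.card_eq_index_normalizer]
  exact card_sylow_modEq_one p G

lemma normal_of_isCoatom_of_card_eq_max_prime [Finite G] [IsModularLattice (Subgroup G)]
    (hp : p.Prime) (hmax : ∀ q : ℕ, q.Prime → q ∣ Nat.card G → q ≤ p)
    (hA : Nat.card A = p) (hAc : IsCoatom A) : A.Normal := by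
  by_contra hAn
  have hN : Subgroup.normalizer (A : Set G) = A :=
    (hAc.le_iff.1 Subgroup.le_normalizer).resolve_left (mt Subgroup.normalizer_eq_top_iff.1 hAn)
  obtain ⟨N, -, hNA, hmod⟩ := exists_normal_isComplement'_of_normalizer_eq hp hA hN
  have hNp : (Nat.card N).Prime := isAtom_iff_card_prime.1 <|
    (IsCompl.isAtom_iff_isCoatom ⟨hNA.disjoint, codisjoint_iff.2 hNA.sup_eq_top⟩).2 hAc
  rcases (hmax _ hNp N.card_subgroup_dvd_card).eq_or_lt with h | h
  · have h0 : Nat.card N ≡ 0 [MOD p] := Nat.modEq_zero_iff_dvd.2 h.symm.dvd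
    exact zero_ne_one ((h0.symm.trans hmod).eq_of_lt_of_lt hp.pos hp.one_lt)
  · exact hNp.ne_one (hmod.eq_of_lt_of_lt h hp.one_lt)

lemma commute_of_mem_of_sup_eq_top [Finite G] [IsModularLattice (Subgroup G)] (hp : p.Prime)
    (hmax : ∀ q : ℕ, q.Prime → q ∣ Nat.card G → q ≤ p) (hA : Nat.card A = p) (hB : Nat.card B = p)
    (hAB : A ≠ B) (hsup : A ⊔ B = ⊤) (hx : x ∈ A) (hy : y ∈ B) : Commute x y := by
  have hAa : IsAtom A := isAtom_iff_card_prime.2 (hA ▸ hp)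
  have hBa : IsAtom B := isAtom_iff_card_prime.2 (hB ▸ hp)
  have hcompl : IsCompl A B := ⟨hAa.disjoint_of_ne hBa hAB, codisjoint_iff.2 hsup⟩
  exact Subgroup.commute_of_normal_of_disjoint A B
    (normal_of_isCoatom_of_card_eq_max_prime hp hmax hA (hcompl.isCoatom_iff_isAtom.2 hBa))
    (normal_of_isCoatom_of_card_eq_max_prime hp hmax hB (hcompl.isAtom_iff_isCoatom.1 hAa))
    hcompl.disjoint x y hx hy

lemma commute_of_pow_max_prime_eq_one [Finite G] [IsModularLattice (Subgroup G)] (hp : p.Prime)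
    (hmax : ∀ q : ℕ, q.Prime → q ∣ Nat.card G → q ≤ p) (hx : x ^ p = 1) (hy : y ^ p = 1) :
    Commute x y := by
  rcases eq_or_ne x 1 with rfl | hx1
  · exact Commute.one_left y
  rcases eq_or_ne y 1 with rfl | hy1
  · exact Commute.one_right x
  set L := Subgroup.zpowers x ⊔ Subgroup.zpowers y
  have hxL : x ∈ L := Subgroup.mem_sup_left (Subgroup.mem_zpowers x)
  have hyL : y ∈ L := Subgroup.mem_sup_right (Subgroup.mem_zpowers y)
  let x' : L := ⟨x, hxL⟩
  let y' : L := ⟨y, hyL⟩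
  have hLmod : IsModularLattice (Subgroup L) :=
    isModularLattice_of_injective ‹_› L.subtype_injective
  have hsup : Subgroup.zpowers x' ⊔ Subgroup.zpowers y' = ⊤ := by
    apply Subgroup.map_injective L.subtype_injective
    rw [Subgroup.map_sup, MonoidHom.map_zpowers, MonoidHom.map_zpowers, ← MonoidHom.range_eq_map,
      Subgroup.range_subtype]
    rfl
  rcases eq_or_ne (Subgroup.zpowers x') (Subgroup.zpowers y') with hxy | hxy
  · obtain ⟨n, hn⟩ := Subgroup.mem_zpowers_iff.1 (hxy ▸ Subgroup.mem_zpowers x')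
    exact congrArg Subtype.val (hn ▸ (Commute.refl y').zpow_left n)
  · exact congrArg Subtype.val <| commute_of_mem_of_sup_eq_top hp
      (fun q hq hd => hmax q hq (hd.trans L.card_subgroup_dvd_card))
      (card_zpowers_of_prime hp (Subtype.ext hx) (by simpa [x'] using hx1))
      (card_zpowers_of_prime hp (Subtype.ext hy) (by simpa [y'] using hy1))
      hxy hsup (Subgroup.mem_zpowers x') (Subgroup.mem_zpowers y')

lemma exists_max_prime_dvd {n : ℕ} (hn : 1 < n) :
    ∃ p : ℕ, p.Prime ∧ p ∣ n ∧ ∀ q : ℕ, q.Prime → q ∣ n → q ≤ p := by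
  obtain ⟨p, hp, hmax⟩ := Finset.exists_max_image _ id (Nat.nonempty_primeFactors.2 hn)
  exact ⟨p, Nat.prime_of_mem_primeFactors hp, Nat.dvd_of_mem_primeFactors hp, fun q hq hd =>
    hmax q (Nat.mem_primeFactors.2 ⟨hq, hd, (zero_lt_one.trans hn).ne'⟩)⟩

lemma card_quotient_lt [Finite G] {N : Subgroup G} (hN : N ≠ ⊥) :
    Nat.card (G ⧸ N) < Nat.card G := by
  rw [N.card_eq_card_quotient_mul_card_subgroup]
  exact lt_mul_of_one_lt_right Nat.card_pos (N.one_lt_card_iff_ne_bot.2 hN)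

lemma card_lt_of_ne_top [Finite G] {N : Subgroup G} (hN : N ≠ ⊤) : Nat.card N < Nat.card G :=
  (Nat.le_of_dvd Nat.card_pos N.card_subgroup_dvd_card).lt_of_ne fun h =>
    hN (Subgroup.eq_top_of_card_eq N h)

lemma closure_pow_eq_one_normal (n : ℕ) : (Subgroup.closure {x : G | x ^ n = 1}).Normal :=
  ⟨fun a ha g => by
    have hle : Subgroup.closure {x : G | x ^ n = 1} ≤
        (Subgroup.closure {x : G | x ^ n = 1}).comap (MulAut.conj g).toMonoidHom :=
      (Subgroup.closure_le _).2 fun x (hx : x ^ n = 1) => Subgroup.subset_closure <|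
        show MulAut.conj g x ^ n = 1 by rw [← map_pow, hx, map_one]
    exact hle ha⟩

theorem isSolvable_of_isModularLattice {G : Type*} [Group G] [Finite G]
    [hG : IsModularLattice (Subgroup G)] : Group.IsSolvable G := by
  induction hn : Nat.card G using Nat.strong_induction_on generalizing G with
  | _ n ih =>
  subst hn
  cases subsingleton_or_nontrivial G
  · infer_instance
  obtain ⟨p, hp, hpd, hmax⟩ := exists_max_prime_dvd (Finite.one_lt_card (α := G))
  have := Fact.mk hp
  let Ω : Subgroup G := Subgroup.closure {x | x ^ p = 1}
  have hΩn : Ω.Normal := closure_pow_eq_one_normal p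
  have hΩcomm : IsMulCommutative Ω := Subgroup.isMulCommutative_closure fun x hx y hy =>
    commute_of_pow_max_prime_eq_one hp hmax hx hy
  have hΩ : Ω ≠ ⊥ := by
    obtain ⟨x, hx⟩ := exists_prime_orderOf_dvd_card' p hpd
    intro h
    have hx1 : x ∈ Ω := Subgroup.subset_closure (show x ^ p = 1 by rw [← hx, pow_orderOf_eq_one])
    rw [h, Subgroup.mem_bot] at hx1
    exact hp.ne_one (hx ▸ hx1 ▸ orderOf_one)
  exact (Group.isSolvable_iff_subgroup_quotient Ω).2 ⟨Group.isSolvable_of_comm mul_comm',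
    ih _ (card_quotient_lt hΩ) (hG := isModularLattice_of_surjective hG
      (QuotientGroup.mk'_surjective Ω)) rfl⟩

end ModularLattice

/-! ### Soluble groups in which modularity is transitive -/

section ModularTransitive

variable {G G' : Type*} [Group G] [Group G']

lemma exists_minimal_normal (G : Type*) [Group G] [Finite G] [Nontrivial G] [Group.IsSolvable G] :
    ∃ P : Subgroup G, P.Normal ∧ P ≠ ⊥ ∧ P ≤ Subgroup.centralizer (P : Set G) ∧
      ∀ N : Subgroup G, N.Normal → N ≤ P → N = ⊥ ∨ N = P := by
  obtain ⟨P, ⟨hPn, hP⟩, hmin⟩ := (wellFounded_lt (α := Subgroup G)).has_min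
    {N : Subgroup G | N.Normal ∧ N ≠ ⊥} ⟨⊤, inferInstance, top_ne_bot⟩
  have hmin' (N : Subgroup G) (hN : N.Normal) (hNP : N ≤ P) : N = ⊥ ∨ N = P := by
    by_contra! hc
    exact hmin N ⟨hN, hc.1⟩ (hNP.lt_of_ne hc.2)
  have hlt := Group.IsSolvable.commutator_lt_of_ne_bot hP
  have hcomm : ⁅P, P⁆ = ⊥ := (hmin' ⁅P, P⁆ inferInstance hlt.le).resolve_right hlt.ne
  exact ⟨P, hPn, hP, Subgroup.commutator_eq_bot_iff_le_centralizer.1 hcomm, hmin'⟩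

/-- Modularity of subgroups is a transitive relation: the case of `IsMSigmaTGroup` in which
`σ` has a single block, so that every subgroup is `σ`-subnormal. -/
def ModularTransitive (G : Type*) [Group G] : Prop :=
  ∀ (K : Subgroup G) (H : Subgroup K), IsModularSubgroup H → IsModularSubgroup K →
    IsModularSubgroup (H.map K.subtype)

lemma modularTransitive_iff :
    ModularTransitive G ↔ IsMSigmaTGroup (fun _ : Unit => {p : ℕ | p.Prime}) G := by
  have hsub {G : Type _} [Group G] (A : Subgroup G) :
      IsSigmaSubnormal (fun _ : Unit => {p : ℕ | p.Prime}) A :=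
    .single ⟨le_top, Or.inr ⟨(), fun p hp _ => hp⟩⟩
  exact ⟨fun hG K H hH hK => ⟨hsub _, hG K H hH.2 hK.2⟩,
    fun hG K H hH hK => (hG K H ⟨hsub _, hH⟩ ⟨hsub _, hK⟩).2⟩

lemma ModularTransitive.of_surjective [Finite G] [Finite G'] {f : G →* G'} (h : ModularTransitive G)
    (hf : Function.Surjective f) : ModularTransitive G' :=
  modularTransitive_iff.2 ((modularTransitive_iff.1 h).of_surjective hf)

lemma ModularTransitive.subgroup (h : ModularTransitive G) {K : Subgroup G}
    (hK : IsModularSubgroup K) : ModularTransitive K := by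
  intro L H hH hL
  let e := L.equivMapOfInjective K.subtype K.subtype_injective
  have hmap : (H.map e.toMonoidHom).map (L.map K.subtype).subtype =
      (H.map L.subtype).map K.subtype := by
    rw [Subgroup.map_map, Subgroup.map_map]
    rfl
  have hH' : IsModularSubgroup (H.map e.toMonoidHom) :=
    Subgroup.map_equiv_eq_comap_symm e H ▸ hH.comap e.symm.surjective
  exact .of_map K.subtype_injective (hmap ▸ h _ _ hH' (h K L hL hK))

lemma normal_inf_of_le_centralizer {C D M : Subgroup G} [C.Normal]
    (hDC : D ≤ Subgroup.centralizer (C : Set G)) (h : D ⊔ M = ⊤) : (M ⊓ C).Normal := by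
  have hM : M ≤ Subgroup.normalizer (M ⊓ C : Subgroup G) :=
    (le_inf Subgroup.le_normalizer (le_top.trans (Subgroup.normalizer_eq_top C).ge)).trans
      Subgroup.inf_normalizer_le_normalizer_inf
  have hD : D ≤ Subgroup.normalizer (M ⊓ C : Subgroup G) :=
    (hDC.trans (Subgroup.centralizer_le fun _ hx => hx.2)).trans
      (Subgroup.centralizer_le_normalizer _)
  rw [← Subgroup.normalizer_eq_top_iff, eq_top_iff, ← h]
  exact sup_le hD hM

theorem ModularTransitive.isModularLattice {G : Type*} [Group G] [Finite G] [Group.IsSolvable G]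
    (hG : ModularTransitive G) : IsModularLattice (Subgroup G) := by
  induction hn : Nat.card G using Nat.strong_induction_on generalizing G with
  | _ n ih =>
  subst hn
  cases subsingleton_or_nontrivial G
  · exact ⟨fun Y Z _ => (Subsingleton.elim _ _).le⟩
  obtain ⟨P, hPn, hP, hPc, hmin⟩ := exists_minimal_normal G
  have hquot : IsModularLattice (Subgroup (G ⧸ P)) :=
    ih _ (card_quotient_lt hP) (hG.of_surjective (QuotientGroup.mk'_surjective P)) rfl
  have hmod (T : Subgroup G) (hT : T ⊔ P ≠ ⊤) : IsModularSubgroup T := by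
    have hTP : IsModularSubgroup (T ⊔ P) := isModularSubgroup_sup_of_quotient hquot T
    have hlat := ih _ (card_lt_of_ne_top hT) (hG.subgroup hTP) rfl
    have := hG (T ⊔ P) (T.subgroupOf (T ⊔ P))
      (isModularLattice_iff_forall_isModularSubgroup.1 hlat _) hTP
    rwa [Subgroup.map_subgroupOf_eq_of_le le_sup_left] at this
  refine ⟨fun {X} Y Z hXZ => ?_⟩
  by_cases hX : X ⊔ P = ⊤
  · have hZ : Z ⊔ P = ⊤ := top_le_iff.1 (hX ▸ sup_le_sup_right hXZ P)
    have hZP : (Z ⊓ P).Normal := normal_inf_of_le_centralizer hPc (sup_comm Z P ▸ hZ)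
    rcases hmin (Z ⊓ P) hZP inf_le_right with h | h
    · have hXZ' : X = Z := by
        have := (isModularSubgroup_of_normal P).1 X Z hXZ
        rwa [hX, top_inf_eq, inf_comm, h, sup_bot_eq] at this
      exact hXZ' ▸ inf_le_right.trans le_sup_left
    · have hZ' : Z = ⊤ := by rwa [sup_eq_left.2 (inf_eq_right.1 h)] at hZ
      rw [hZ', inf_top_eq, inf_top_eq]
  · exact ((hmod X hX).2 Y Z hXZ).ge

end ModularTransitive

/-! ### The structure conditions imply that `σ`-quasinormality is transitive -/

section ModularOverHall

variable {G : Type*} [Group G] {A D U V : Subgroup G}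

lemma exists_normal_le_centralizer_of_coprime [D.Normal] (hD : IsHallSubgroup D)
    (hAD : (Nat.card A).Coprime (Nat.card D)) (hA : A ≤ Subgroup.centralizer (D : Set G)) :
    ∃ C : Subgroup G, C.Normal ∧ A ≤ C ∧ C ≤ Subgroup.centralizer (D : Set G) ∧
      (Nat.card D).Coprime (Nat.card C) := by
  obtain ⟨M, hM⟩ := Subgroup.exists_right_complement'_of_coprime hD
  refine ⟨M ⊓ Subgroup.centralizer (D : Set G), normal_inf_of_le_centralizer
    (Subgroup.le_centralizer_iff.1 le_rfl) hM.sup_eq_top, le_inf (fun a ha => ?_) hA,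
    inf_le_right, Nat.Coprime.coprime_dvd_right (Subgroup.card_dvd_of_le inf_le_left)
      (hM.symm.index_eq_card ▸ hD)⟩
  obtain ⟨d, hd, m, hm, rfl⟩ :=
    Subgroup.mem_sup_of_normal_left.1 (hM.sup_eq_top ▸ Subgroup.mem_top a)
  have hcomm : Commute (d * m) d⁻¹ :=
    (Subgroup.mem_centralizer_iff.1 (hA ha) d⁻¹ (D.inv_mem hd)).symm
  refine mem_of_mul_mem_of_coprime hAD hcomm (pow_card_eq_one_of_mem ha)
    (pow_card_eq_one_of_mem (D.inv_mem hd)) ?_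
  rwa [hcomm.eq, inv_mul_cancel_left]

lemma sup_inf_le_of_le_centralizer [D.Normal] (hD : IsHallSubgroup D)
    (hAD : (Nat.card A).Coprime (Nat.card D)) (hA : A ≤ Subgroup.centralizer (D : Set G))
    (X : Subgroup G) : (X ⊔ A) ⊓ D ≤ X := by
  obtain ⟨C, hC, hAC, hCD, hcop⟩ := exists_normal_le_centralizer_of_coprime hD hAD hA
  rintro g ⟨hg, hgD⟩
  obtain ⟨x, hx, c, hc, rfl⟩ := Subgroup.mem_sup_of_normal_right.1 (sup_le_sup_left hAC X hg)
  have hcomm : Commute (x * c) c⁻¹ :=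
    Subgroup.mem_centralizer_iff.1 (hCD (C.inv_mem hc)) (x * c) hgD
  refine mem_of_mul_mem_of_coprime hcop hcomm (pow_card_eq_one_of_mem hgD)
    (pow_card_eq_one_of_mem (C.inv_mem hc)) ?_
  rwa [mul_inv_cancel_right]

lemma le_of_le_sup_of_inf_le [D.Normal] (hVU : V ≤ U) (hUV : U ≤ V ⊔ D) (hUD : U ⊓ D ≤ V) :
    U ≤ V :=
  calc U ≤ (V ⊔ D) ⊓ U := le_inf hUV le_rfl
    _ = V ⊔ (D ⊓ U) := ((isModularSubgroup_of_normal D).1 V U hVU).symm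
    _ ≤ V := sup_le le_rfl (inf_comm D U ▸ hUD)

lemma sup_inf_le_inf_sup_of_le_centralizer [D.Normal]
    (hAD : (Nat.card A).Coprime (Nat.card D)) (hA : A ≤ Subgroup.centralizer (D : Set G))
    (Z : Subgroup G) : (A ⊔ D) ⊓ Z ≤ (A ⊓ Z) ⊔ D := by
  rintro z ⟨hz, hzZ⟩
  obtain ⟨a, ha, d, hd, rfl⟩ := Subgroup.mem_sup_of_normal_right.1 hz
  have haZ : a ∈ Z := mem_of_mul_mem_of_coprime hAD
    (Subgroup.mem_centralizer_iff.1 (hA ha) d hd).symm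
    (pow_card_eq_one_of_mem ha) (pow_card_eq_one_of_mem hd) hzZ
  exact Subgroup.mul_mem_sup ⟨ha, haZ⟩ hd

lemma inf_sup_le_of_sup_inf_le [D.Normal] {Y : Subgroup G} (hYD : (A ⊔ Y) ⊓ D ≤ Y)
    (hU : U ≤ A ⊔ Y) : Y ⊓ (U ⊔ D) ≤ (Y ⊓ U) ⊔ D := by
  rintro y ⟨hy, hyUD⟩
  obtain ⟨u, hu, d, hd, rfl⟩ := Subgroup.mem_sup_of_normal_right.1 hyUD
  have hdY : d ∈ Y := hYD ⟨((A ⊔ Y).mul_mem_cancel_left (hU hu)).1 (Subgroup.mem_sup_right hy), hd⟩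
  exact Subgroup.mul_mem_sup ⟨(Y.mul_mem_cancel_right hdY).1 hy, hu⟩ hd

lemma isModularSubgroup_of_le_centralizer [D.Normal] (hD : IsHallSubgroup D)
    (hAD : (Nat.card A).Coprime (Nat.card D)) (hA : A ≤ Subgroup.centralizer (D : Set G))
    (hmod : IsModularSubgroup (A ⊔ D)) : IsModularSubgroup A := by
  have hXD := sup_inf_le_of_le_centralizer hD hAD hA
  refine isModularSubgroup_iff_le.2 ⟨fun X Z hXZ => ?_, fun Y Z hAZ => ?_⟩
  · refine le_of_le_sup_of_inf_le (D := D)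
      (le_inf (sup_le_sup_left inf_le_left X) (sup_le hXZ inf_le_right)) ?_
      ((inf_le_inf_right D inf_le_left).trans ((hXD X).trans le_sup_left))
    calc (X ⊔ A) ⊓ Z ≤ (X ⊔ (A ⊔ D)) ⊓ Z := inf_le_inf_right Z (sup_le_sup_left le_sup_left X)
      _ = X ⊔ ((A ⊔ D) ⊓ Z) := (hmod.1 X Z hXZ).symm
      _ ≤ X ⊔ ((A ⊓ Z) ⊔ D) :=
        sup_le_sup_left (sup_inf_le_inf_sup_of_le_centralizer hAD hA Z) X
      _ = X ⊔ (A ⊓ Z) ⊔ D := (sup_assoc ..).symm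
  · set U := (A ⊔ Y) ⊓ Z
    have hAU : A ≤ U := le_inf le_sup_left hAZ
    have hYD : (A ⊔ Y) ⊓ D ≤ Y := sup_comm A Y ▸ hXD Y
    refine le_of_le_sup_of_inf_le (D := D) (sup_le hAU (le_inf (inf_le_left.trans le_sup_right)
      inf_le_right)) ?_ (le_sup_of_le_right (le_inf ((inf_le_inf_right D inf_le_left).trans hYD)
        (inf_le_left.trans inf_le_right)))
    calc U ≤ (A ⊔ D ⊔ Y) ⊓ (U ⊔ D) :=
          le_inf (inf_le_left.trans (sup_le_sup_right le_sup_left Y)) le_sup_left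
      _ = A ⊔ D ⊔ (Y ⊓ (U ⊔ D)) := (hmod.2 Y (U ⊔ D) (sup_le_sup_right hAU D)).symm
      _ ≤ A ⊔ D ⊔ ((Y ⊓ U) ⊔ D) := sup_le_sup_left (inf_sup_le_of_sup_inf_le hYD inf_le_left) _
      _ ≤ A ⊔ (Y ⊓ Z) ⊔ D := sup_le (sup_le_sup_right le_sup_left D) (sup_le_sup_right
        (le_sup_of_le_right (inf_le_inf_left Y inf_le_right)) D)

end ModularOverHall

section Sufficiency

variable {ι : Type*} {σ : ι → Set ℕ} {G : Type*} [Group G]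

lemma piCore_eq_piClosure {π : Set ℕ} [IsMulCommutative G] [Finite G] :
    piCore π G = piClosure π ⊤ := by
  refine le_antisymm (sSup_le fun N hN => ?_) (le_sSup ⟨inferInstance, isPiGroup_piClosure ?_⟩)
  · refine le_of_forall_isPElement fun q hq x hx hxq => ?_
    by_cases hqπ : q ∈ π
    · exact hxq.mem_piClosure hq hqπ trivial
    · exact isPiGroup_subgroup_iff.1 hN.2 q hq hqπ x hx hxq ▸ Subgroup.one_mem _
  · exact fun x _ => Subgroup.mem_centralizer_iff.2 fun y _ => mul_comm' y x

lemma map_subtype_piCore {π : Set ℕ} [Finite G] (D : Subgroup G) [IsMulCommutative D] :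
    (piCore π D).map D.subtype = piClosure π D := by
  rw [piCore_eq_piClosure, map_piClosure, ← MonoidHom.range_eq_map, Subgroup.range_subtype]

lemma HasNormalComplementIn.le_centralizer {E H : Subgroup G} [hE : E.Normal] [IsMulCommutative E]
    (h : HasNormalComplementIn E H) : H ≤ Subgroup.centralizer (E : Set G) := by
  obtain ⟨hEH, T, hT, hc⟩ := h
  have hTE : T ≤ Subgroup.centralizer (E.subgroupOf H : Set H) :=
    fun t ht => Subgroup.mem_centralizer_iff.2 fun e he =>
      Subgroup.commute_of_normal_of_disjoint _ _ (hE.subgroupOf H) hT hc.disjoint e t he ht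
  have hEE : E.subgroupOf H ≤ Subgroup.centralizer (E.subgroupOf H : Set H) :=
    Subgroup.le_centralizer_iff_isMulCommutative.2 inferInstance
  have htop : (⊤ : Subgroup H) ≤ Subgroup.centralizer (E.subgroupOf H : Set H) :=
    hc.sup_eq_top.ge.trans (sup_le hEE hTE)
  exact fun h hh => Subgroup.mem_centralizer_iff.2 fun e he => congrArg Subtype.val <|
    Subgroup.mem_centralizer_iff.1 (htop (Subgroup.mem_top ⟨h, hh⟩)) ⟨e, hEH he⟩ he

lemma IsPElement.commute_of_commute_commutatorElement {p n : ℕ} {x d : G} (hx : IsPElement p x)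
    (hn : n.Coprime p) (h : Commute x ⁅x, d⁆) (hd : ⁅x, d⁆ ^ n = 1) : Commute x d := by
  have hconj : x⁻¹ * ⁅x, d⁆ = d * x⁻¹ * d⁻¹ := by rw [commutatorElement_def]; group
  exact commutatorElement_eq_one_iff_commute.1 <|
    hx.inv.eq_one_of_mul (hconj ▸ hx.inv.conj d) h.inv_left hn hd

lemma commutatorElement_mem_of_mem_normalizer {N : Subgroup G} {x d : G} (hx : x ∈ N)
    (hd : d ∈ Subgroup.normalizer (N : Set G)) : ⁅x, d⁆ ∈ N := by
  rw [commutatorElement_def, mul_assoc, mul_assoc, ← mul_assoc d]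
  exact N.mul_mem hx ((Subgroup.mem_normalizer_iff.1 hd _).1 (N.inv_mem hx))

lemma surjective_comp_subtype {G' : Type*} [Group G'] {f : G →* G'} (hf : Function.Surjective f)
    {D M : Subgroup G} (hDM : D ⊔ M = ⊤) (hD : D ≤ f.ker) :
    Function.Surjective (f.comp M.subtype) := by
  rw [← MonoidHom.range_eq_top, MonoidHom.range_comp, Subgroup.range_subtype]
  rw [← MonoidHom.range_eq_top, MonoidHom.range_eq_map, ← hDM, Subgroup.map_sup,
    (Subgroup.map_eq_bot_iff D).2 hD, bot_sup_eq] at hf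
  exact hf

namespace StructureConditions

variable {D M A B C E : Subgroup G} {p q : ℕ} {x d : G}

lemma normal_of_le (S : StructureConditions σ D M) (hE : E ≤ D) : E.Normal := by
  have := S.normal
  refine ⟨fun e he g => ?_⟩
  have hmap : (MulAut.conjNormal g : MulAut D) ⟨e, hE he⟩ ∈ E.subgroupOf D :=
    S.power g (E.subgroupOf D) ▸ Subgroup.mem_map_of_mem _ (Subgroup.mem_subgroupOf.2 he)
  simpa only [Subgroup.mem_subgroupOf, MulAut.conjNormal_apply] using hmap

lemma commute_of_mem_block [Finite G] (S : StructureConditions σ D M) {i : ι}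
    (hp : p.Prime) (hq : q.Prime) (hpi : p ∈ σ i) (hqi : q ∈ σ i)
    (hx : IsPElement p x) (hd : d ∈ D) (hdq : IsPElement q d) : Commute x d := by
  have := S.abelian
  obtain ⟨H, hH, hE⟩ := S.complement i
  rw [map_subtype_piCore] at hE
  have hEn : (piClosure (σ i) D).Normal := S.normal_of_le piClosure_le
  have hEc : IsMulCommutative (piClosure (σ i) D) :=
    Subgroup.le_centralizer_iff_isMulCommutative.1 <| piClosure_le.trans <|
      (Subgroup.le_centralizer D).trans (Subgroup.centralizer_le piClosure_le)
  have hHC := hE.le_centralizer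
  have hxC : x ∈ Subgroup.centralizer (piClosure (σ i) D : Set G) :=
    hx.mem_of_not_dvd_index hp fun hdvd =>
      hH.2 p hp (hdvd.trans (Subgroup.index_dvd_of_le hHC)) hpi
  exact (Subgroup.mem_centralizer_iff.1 hxC d (hdq.mem_piClosure hq hqi hd)).symm

lemma isSolvable [Finite G] (S : StructureConditions σ D M) : Group.IsSolvable G := by
  have := S.normal
  have := S.abelian
  have := S.modular
  have hM : Group.IsSolvable M := isSolvable_of_isModularLattice
  have hquot : Group.IsSolvable (G ⧸ D) := Group.isSolvable_of_surjective <|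
    surjective_comp_subtype (QuotientGroup.mk'_surjective D) S.compl.sup_eq_top
      (QuotientGroup.ker_mk' D).ge
  exact (Group.isSolvable_iff_subgroup_quotient D).2
    ⟨Group.isSolvable_of_comm mul_comm', hquot⟩

lemma commute_mk_of_sigmaSubnormalStep [Finite G] (S : StructureConditions σ D M) [E.Normal]
    (hp : p.Prime) (hpD : ¬ p ∣ Nat.card D) (hx : IsPElement p x) (hxB : x ∈ B)
    (hstep : SigmaSubnormalStep σ B C)
    (hB : ∀ d ∈ D ⊓ B, Commute (QuotientGroup.mk' E x) (QuotientGroup.mk' E d)) :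
    ∀ d ∈ D ⊓ C, Commute (QuotientGroup.mk' E x) (QuotientGroup.mk' E d) := by
  have hDn := S.normal
  set φ := QuotientGroup.mk' E
  have hcomm (d : G) (hd : d ∈ D) (hxd : ⁅x, d⁆ ∈ B) : Commute (φ x) (φ d) := by
    have hxdD : ⁅x, d⁆ ∈ D := D.mul_mem (hDn.conj_mem d hd x) (D.inv_mem hd)
    refine (hx.map φ).commute_of_commute_commutatorElement
      (hp.coprime_iff_not_dvd.2 hpD).symm ?_ ?_ <;> rw [← map_commutatorElement]
    · exact hB _ ⟨hxdD, hxd⟩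
    · rw [← map_pow, pow_card_eq_one_of_mem hxdD, map_one]
  rw [sigmaSubnormalStep_iff] at hstep
  obtain ⟨hBC, hCB | ⟨l, hl⟩⟩ := hstep
  · exact fun d hd => hcomm d hd.1 (commutatorElement_mem_of_mem_normalizer hxB (hCB hd.2))
  suffices hle : D ⊓ C ≤ (Subgroup.centralizer {φ x}).comap φ from
    fun d hd => (Subgroup.mem_centralizer_singleton_iff.1 (hle hd)).symm
  refine le_of_forall_isPElement fun r hr d hd hdr => Subgroup.mem_centralizer_singleton_iff.2 ?_
  symm
  by_cases hrl : r ∈ σ l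
  · by_cases hpl : p ∈ σ l
    · exact (S.commute_of_mem_block hp hr hpl hrl hx hd.1 hdr).map φ
    · exact hcomm d hd.1 <| hl <| commutatorElement_mem_of_mem_normalizer
        (hx.mem_piClosure hp hpl (hBC hxB))
        (normalizer_le_normalizer_piClosure (Subgroup.le_normalizer hd.2))
  · exact hB d ⟨hd.1, hl (hdr.mem_piClosure hr hrl hd.2)⟩

lemma commute_mk_of_isSigmaSubnormal [Finite G] (S : StructureConditions σ D M) [E.Normal]
    (hE : D ⊓ A ≤ E) (hA : IsSigmaSubnormal σ A) (hp : p.Prime) (hpD : ¬ p ∣ Nat.card D)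
    (hxA : x ∈ A) (hx : IsPElement p x) (hd : d ∈ D) :
    Commute (QuotientGroup.mk' E x) (QuotientGroup.mk' E d) := by
  suffices h : ∀ B, Relation.ReflTransGen (SigmaSubnormalStep σ) A B → x ∈ B ∧
      ∀ d ∈ D ⊓ B, Commute (QuotientGroup.mk' E x) (QuotientGroup.mk' E d) from
    (h ⊤ hA).2 d ⟨hd, trivial⟩
  intro B hAB
  induction hAB with
  | refl =>
    refine ⟨hxA, fun d hd => ?_⟩
    rw [QuotientGroup.mk'_apply, QuotientGroup.mk'_apply, (QuotientGroup.eq_one_iff d).2 (hE hd)]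
    exact Commute.one_right _
  | tail _ hstep ih =>
    exact ⟨hstep.1 ih.1, S.commute_mk_of_sigmaSubnormalStep hp hpD hx ih.1 hstep ih.2⟩

lemma mem_of_dvd_card (S : StructureConditions σ D M) (hp : p.Prime) (hpD : p ∣ Nat.card D)
    (hx : IsPElement p x) : x ∈ D :=
  have := S.normal
  hx.mem_of_not_dvd_index hp fun hd => Nat.not_coprime_of_dvd_of_dvd hp.one_lt hpD hd S.hall

lemma map_mk_le_centralizer [Finite G] (S : StructureConditions σ D M) [E.Normal]
    (hE : D ⊓ A ≤ E) (hA : IsSigmaSubnormal σ A) : A.map (QuotientGroup.mk' E) ≤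
      Subgroup.centralizer (D.map (QuotientGroup.mk' E) : Set (G ⧸ E)) := by
  rw [Subgroup.map_le_iff_le_comap]
  refine le_of_forall_isPElement fun p hp x hxA hx => Subgroup.mem_centralizer_iff.2 ?_
  rintro _ ⟨d, hd, rfl⟩
  by_cases hpD : p ∣ Nat.card D
  · rw [QuotientGroup.mk'_apply, QuotientGroup.mk'_apply,
      (QuotientGroup.eq_one_iff x).2 (hE ⟨S.mem_of_dvd_card hp hpD hx, hxA⟩)]
    exact Commute.one_right _
  · exact (S.commute_mk_of_isSigmaSubnormal hE hA hp hpD hxA hx hd).symm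

lemma isModularSubgroup [Finite G] (S : StructureConditions σ D M)
    (hA : IsSigmaSubnormal σ A) : IsModularSubgroup A := by
  have hDn := S.normal
  have hEn : (D ⊓ A).Normal := S.normal_of_le inf_le_left
  set φ := QuotientGroup.mk' (D ⊓ A)
  have hφ : Function.Surjective φ := QuotientGroup.mk'_surjective _
  have hker : φ.ker = D ⊓ A := QuotientGroup.ker_mk' _
  have hDφ : (D.map φ).Normal := hDn.map φ hφ
  have hAφ : (A.map φ).comap φ = A := Subgroup.comap_map_eq_self (hker.le.trans inf_le_right)
  have hHall : IsHallSubgroup (D.map φ) :=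
    Nat.Coprime.of_dvd (Subgroup.card_map_dvd D φ) (Subgroup.index_map_dvd D hφ) S.hall
  have hcop : (Nat.card (A.map φ)).Coprime (Nat.card (D.map φ)) := by
    refine Nat.Coprime.of_dvd ?_ (Subgroup.card_map_dvd D φ) S.hall.symm
    rw [← Subgroup.relIndex_ker, hker, Subgroup.inf_relIndex_right]
    exact D.relIndex_dvd_index_of_normal A
  have hmod : IsModularLattice (Subgroup ((G ⧸ D ⊓ A) ⧸ D.map φ)) := by
    refine isModularLattice_of_surjective S.modular
      (f := ((QuotientGroup.mk' (D.map φ)).comp φ).comp M.subtype) <| surjective_comp_subtype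
        (f := (QuotientGroup.mk' (D.map φ)).comp φ)
        ((QuotientGroup.mk'_surjective _).comp hφ) S.compl.sup_eq_top fun d hd => ?_
    exact (QuotientGroup.eq_one_iff _).2 (Subgroup.mem_map_of_mem φ hd)
  rw [← hAφ, isModularSubgroup_comap_iff hφ]
  exact isModularSubgroup_of_le_centralizer hHall hcop (S.map_mk_le_centralizer le_rfl hA)
    (isModularSubgroup_sup_of_quotient hmod _)

theorem isMSigmaTGroup [Finite G] (S : StructureConditions σ D M) : IsMSigmaTGroup σ G :=
  fun _ _ hH hK => ⟨hH.1.trans hK.1, S.isModularSubgroup (hH.1.trans hK.1)⟩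

end StructureConditions

end Sufficiency

/-! ### Power automorphisms of `p`-groups of order prime to `p` -/

section PowerAut

variable {P : Type*} [Group P] {p q : ℕ} {α : MulAut P} {x y a b : P} {k l : ℤ}

lemma zpow_eq_zpow_iff_cast_eq (hx : orderOf x = p) : x ^ k = x ^ l ↔ (k : ZMod p) = l := by
  rw [zpow_eq_zpow_iff_modEq, hx, ZMod.intCast_eq_intCast_iff]

lemma IsPElement.exists_orderOf_pow_eq (hx : IsPElement p x) (hp : p.Prime) (hx1 : x ≠ 1) :
    ∃ n : ℕ, orderOf (x ^ n) = p := by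
  obtain ⟨e, he⟩ := hx
  obtain ⟨k, -, hk⟩ := (Nat.dvd_prime_pow hp).1 (orderOf_dvd_of_pow_eq_one he)
  have hk0 : k ≠ 0 := fun h => hx1 (orderOf_eq_one_iff.1 (by rw [hk, h, pow_zero]))
  exact ⟨orderOf x / p, orderOf_pow_orderOf_div (hk ▸ pow_ne_zero k hp.ne_zero)
    (hk ▸ dvd_pow_self p hk0)⟩

lemma IsPElement.orderOf_coprime (hx : IsPElement q x) (hp : p.Prime) (hq : q.Prime)
    (hqp : q ≠ p) : (orderOf x).Coprime p := by
  obtain ⟨k, hk⟩ := hx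
  exact (((Nat.coprime_primes hq hp).2 hqp).pow_left k).coprime_dvd_left
    (orderOf_dvd_of_pow_eq_one hk)

lemma commutatorElement_zpow_right (h : Commute ⁅a, b⁆ b) (l : ℤ) :
    ⁅a, b ^ l⁆ = ⁅a, b⁆ ^ l := by
  have hconj : a * b * a⁻¹ = ⁅a, b⁆ * b := by rw [commutatorElement_def]; group
  rw [commutatorElement_def, ← conj_zpow, hconj, h.mul_zpow, mul_inv_cancel_right]

lemma commutatorElement_zpow_left (h : Commute ⁅a, b⁆ a) (k : ℤ) :
    ⁅a ^ k, b⁆ = ⁅a, b⁆ ^ k := by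
  rw [← commutatorElement_inv b, ← commutatorElement_inv b a, inv_zpow,
    commutatorElement_zpow_right (commutatorElement_inv a b ▸ h.inv_left)]

lemma exists_commutatorElement_mem_center [Group.IsNilpotent P] (hxy : ¬ Commute x y) :
    ∃ a b : P, ⁅a, b⁆ ∈ Subgroup.center P ∧ ⁅a, b⁆ ≠ 1 := by
  have hxZ : x ∉ Subgroup.center P := fun h => hxy (Subgroup.mem_center_iff.1 h y).symm
  have : Nontrivial (P ⧸ Subgroup.center P) :=
    ⟨x, 1, fun h => hxZ ((QuotientGroup.eq_one_iff x).1 h)⟩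
  obtain ⟨⟨z, hz⟩, hz1⟩ := (Subgroup.center (P ⧸ Subgroup.center P)).ne_bot_iff_exists_ne_one.1
    (Group.IsNilpotent.center_ne_bot _)
  obtain ⟨a, rfl⟩ := QuotientGroup.mk'_surjective (Subgroup.center P) z
  have haZ : a ∉ Subgroup.center P := fun h =>
    hz1 (Subtype.ext ((QuotientGroup.eq_one_iff a).2 h))
  obtain ⟨b, hb⟩ : ∃ b : P, ¬ Commute b a := by
    by_contra! h
    exact haZ (Subgroup.mem_center_iff.2 h)
  refine ⟨a, b, ?_, fun h => hb (commutatorElement_eq_one_iff_commute.1 h).symm⟩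
  rw [← QuotientGroup.eq_one_iff, ← QuotientGroup.mk'_apply, map_commutatorElement,
    commutatorElement_eq_one_iff_commute]
  exact (Subgroup.mem_center_iff.1 hz _).symm

lemma pow_apply_eq_zpow (hk : α x = x ^ k) (n : ℕ) : (α ^ n) x = x ^ (k ^ n) := by
  induction n with
  | zero => rw [pow_zero, pow_zero, zpow_one, MulAut.one_apply]
  | succ n ih => rw [pow_succ, MulAut.mul_apply, hk, map_zpow, ih, ← zpow_mul, pow_succ]

/-- If `x ^ p ^ e = 1`, then `k ≡ 1` modulo `p` yields `k ^ p ^ e ≡ 1` modulo `p ^ e`, so that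
`α ^ p ^ e` fixes `x`. -/
lemma apply_eq_self_of_coprime (hα : (orderOf α).Coprime p) (hx : IsPElement p x)
    (hk : α x = x ^ k) (hk1 : (k : ZMod p) = 1) : α x = x := by
  obtain ⟨e, he⟩ := hx
  have hdvd : ((p ^ e : ℕ) : ℤ) ∣ k ^ p ^ e - 1 := by
    have hp : (p : ℤ) ∣ k - 1 := by
      rw [← ZMod.intCast_zmod_eq_zero_iff_dvd, Int.cast_sub, hk1, Int.cast_one, sub_self]
    simpa using (pow_dvd_pow (p : ℤ) e.le_succ).trans (dvd_sub_pow_of_dvd_sub hp e)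
  have hfix : (α ^ p ^ e) x = x := by
    rw [pow_apply_eq_zpow hk, ← mul_inv_eq_one, ← zpow_sub_one, orderOf_dvd_iff_zpow_eq_one.symm]
    exact (Int.natCast_dvd_natCast.2 (orderOf_dvd_of_pow_eq_one he)).trans hdvd
  refine mem_of_pow_mem_of_coprime (H := MulAction.stabilizer (MulAut P) x)
    (hα.pow_right e) ?_ hfix
  exact pow_orderOf_eq_one α ▸ Subgroup.one_mem _

lemma IsPowerAutomorphism.exists_zpow (hα : IsPowerAutomorphism α) (x : P) :
    ∃ k : ℤ, α x = x ^ k := by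
  obtain ⟨k, hk⟩ := Subgroup.mem_zpowers_iff.1
    (hα (Subgroup.zpowers x) ▸ Subgroup.mem_map_of_mem _ (Subgroup.mem_zpowers x))
  exact ⟨k, hk.symm⟩

lemma cast_ne_zero_of_apply_eq_zpow (hx : orderOf x = p) (hp : p.Prime)
    (hk : α x = x ^ k) : (k : ZMod p) ≠ 0 := by
  rw [← Int.cast_zero, Ne, ← zpow_eq_zpow_iff_cast_eq hx, ← hk, zpow_zero]
  rintro h
  rw [(map_eq_one_iff α α.injective).1 h, orderOf_one] at hx
  exact hp.ne_one hx.symm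

lemma pow_apply_zpow (hk : α x = x ^ k) (n : ℕ) : α (x ^ n) = (x ^ n) ^ k := by
  rw [map_pow, hk, ← zpow_natCast, ← zpow_natCast, zpow_comm]

lemma IsPowerAutomorphism.cast_eq_of_orderOf_eq [Finite P] (hα : IsPowerAutomorphism α)
    (hp : p.Prime) (ha : orderOf a = p) (hb : orderOf b = p) (hab : Commute a b)
    (hk : α a = a ^ k) (hl : α b = b ^ l) : (k : ZMod p) = l := by
  by_cases hmem : a ∈ Subgroup.zpowers b
  · obtain ⟨j, rfl⟩ := hmem
    rw [← zpow_eq_zpow_iff_cast_eq ha, ← hk, map_zpow, hl, zpow_comm]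
  · have hdisj : Disjoint (Subgroup.zpowers a) (Subgroup.zpowers b) := by
      refine IsAtom.disjoint_of_ne (isAtom_iff_card_prime.2 ?_) (isAtom_iff_card_prime.2 ?_)
        fun h => hmem (h ▸ Subgroup.mem_zpowers a) <;> rwa [Nat.card_zpowers, ‹orderOf _ = p›]
    obtain ⟨t, ht⟩ := hα.exists_zpow (a * b)
    rw [map_mul, hk, hl, hab.mul_zpow] at ht
    have hinj := Subgroup.mul_injective_of_disjoint hdisj
      (a₁ := (⟨a ^ k, Subgroup.zpow_mem_zpowers a k⟩, ⟨b ^ l, Subgroup.zpow_mem_zpowers b l⟩))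
      (a₂ := (⟨a ^ t, Subgroup.zpow_mem_zpowers a t⟩, ⟨b ^ t, Subgroup.zpow_mem_zpowers b t⟩)) ht
    rw [Prod.mk.injEq, Subtype.mk_eq_mk, Subtype.mk_eq_mk, zpow_eq_zpow_iff_cast_eq ha,
      zpow_eq_zpow_iff_cast_eq hb] at hinj
    exact hinj.1.trans hinj.2.symm

lemma IsPowerAutomorphism.exists_cast_eq [Finite P] (hα : IsPowerAutomorphism α)
    (hp : p.Prime) (hP : IsPGroup p P) :
    ∃ c : ZMod p, ∀ x : P, x ≠ 1 → ∀ k : ℤ, α x = x ^ k → (k : ZMod p) = c := by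
  have := Fact.mk hp
  cases subsingleton_or_nontrivial P
  · exact ⟨1, fun x hx => absurd (Subsingleton.elim x 1) hx⟩
  have := hP.center_nontrivial
  obtain ⟨⟨z, hz⟩, hz1⟩ := exists_ne (1 : Subgroup.center P)
  obtain ⟨m, hm⟩ := IsPElement.exists_orderOf_pow_eq (hP z) hp fun h => hz1 (Subtype.ext h)
  obtain ⟨l, hl⟩ := hα.exists_zpow z
  refine ⟨l, fun x hx k hk => ?_⟩
  obtain ⟨n, hn⟩ := IsPElement.exists_orderOf_pow_eq (hP x) hp hx
  exact hα.cast_eq_of_orderOf_eq hp hn hm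
    (Commute.pow_pow (Subgroup.mem_center_iff.1 hz x) n m) (pow_apply_zpow hk n)
    (pow_apply_zpow hl m)

lemma IsPowerAutomorphism.eq_one_of_apply_eq_zpow [Finite P] (hα : IsPowerAutomorphism α)
    (hp : p.Prime) (hP : IsPGroup p P) (hcop : (orderOf α).Coprime p) (hx1 : x ≠ 1)
    (hk : α x = x ^ k) (hk1 : (k : ZMod p) = 1) : α = 1 := by
  obtain ⟨c, hc⟩ := hα.exists_cast_eq hp hP
  ext y
  by_cases hy1 : y = 1
  · rw [hy1, map_one, map_one]
  obtain ⟨l, hl⟩ := hα.exists_zpow y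
  exact apply_eq_self_of_coprime hcop (hP y) hl
    ((hc y hy1 l hl).trans ((hc x hx1 k hk).symm.trans hk1))

/-- If `α` raises every element to a power congruent to `c` modulo `p`, then on a nontrivial
central commutator it acts both as `c` and as `c ^ 2`, so that `c = 1`. -/
lemma IsPowerAutomorphism.isMulCommutative [Finite P] (hα : IsPowerAutomorphism α)
    (hp : p.Prime) (hP : IsPGroup p P) (hcop : (orderOf α).Coprime p) (hα1 : α ≠ 1) :
    IsMulCommutative P := by
  have := Fact.mk hp
  have := hP.isNilpotent
  by_contra hcomm
  obtain ⟨x, y, hxy⟩ : ∃ x y : P, ¬ Commute x y := by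
    by_contra! h
    exact hcomm ⟨⟨h⟩⟩
  obtain ⟨a, b, hZ, hab⟩ := exists_commutatorElement_mem_center hxy
  have hcen (g : P) : Commute ⁅a, b⁆ g := (Subgroup.mem_center_iff.1 hZ g).symm
  obtain ⟨c, hc⟩ := hα.exists_cast_eq hp hP
  obtain ⟨k, hk⟩ := hα.exists_zpow a
  obtain ⟨l, hl⟩ := hα.exists_zpow b
  obtain ⟨n, hn⟩ := IsPElement.exists_orderOf_pow_eq (hP ⁅a, b⁆) hp hab
  have ha1 : a ≠ 1 := fun h => hab (h ▸ commutatorElement_one_left b)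
  have hb1 : b ≠ 1 := fun h => hab (h ▸ commutatorElement_one_right a)
  have hkl : α ⁅a, b⁆ = ⁅a, b⁆ ^ (k * l) := by
    have hleft := commutatorElement_zpow_left (hcen a) k
    rw [map_commutatorElement, hk, hl,
      commutatorElement_zpow_right (hleft ▸ (hcen b).zpow_left k), hleft, zpow_mul]
  have hc2 : c * c = c := by
    simpa [hc a ha1 k hk, hc b hb1 l hl] using hc _ hab _ hkl
  have hc0 : c ≠ 0 := hc _ hab _ hkl ▸ cast_ne_zero_of_apply_eq_zpow hn hp (pow_apply_zpow hkl n)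
  exact hα1 (hα.eq_one_of_apply_eq_zpow hp hP hcop ha1 hk
    ((hc a ha1 k hk).trans (mul_right_cancel₀ hc0 (hc2.trans (one_mul c).symm))))

end PowerAut

/-! ### Normal `p`-subgroups of `MσT`-groups -/

section NormalPSubgroups

variable {ι : Type*} {σ : ι → Set ℕ} {G : Type*} [Group G] {p q : ℕ} {P A : Subgroup G} {y : G}

lemma IsMSigmaTGroup.isSigmaQuasinormal_of_le [Finite G] (hG : IsMSigmaTGroup σ G)
    (hp : p.Prime) [P.Normal] (hP : IsPGroup p P) (hA : A ≤ P) : IsSigmaQuasinormal σ A := by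
  have := Fact.mk hp
  induction A using WellFoundedGT.induction with
  | ind A ih =>
  rcases hA.eq_or_lt with rfl | hlt
  · exact isSigmaQuasinormal_of_normal A
  let B := Subgroup.normalizer (A : Set G) ⊓ P
  have hAB : A < B := by
    have := hP.isNilpotent
    have hN := Group.normalizerCondition_of_isNilpotent (A.subgroupOf P)
      (lt_top_iff_ne_top.2 (mt Subgroup.subgroupOf_eq_top.1 hlt.not_ge))
    rw [← Subgroup.subgroupOf_normalizer_eq hA,
      ← Subgroup.map_lt_map_iff_of_injective P.subtype_injective,
      Subgroup.map_subgroupOf_eq_of_le hA, Subgroup.subgroupOf_map_subtype] at hN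
    exact hN
  have := (Subgroup.normal_subgroupOf_iff_le_normalizer hAB.le).2 inf_le_left
  exact hG.trans hAB.le (isSigmaQuasinormal_of_normal _) (ih B hAB inf_le_right)

-- The modular law for `A` and `⟨y⟩ ≤ G` gives `A = (A ⊔ ⟨y⟩) ⊓ P`, which `y` normalizes.
lemma IsMSigmaTGroup.mem_normalizer [Finite G] (hG : IsMSigmaTGroup σ G) (hp : p.Prime)
    (hq : q.Prime) (hqp : q ≠ p) [hPn : P.Normal] (hP : IsPGroup p P) (hA : A ≤ P)
    (hy : IsPElement q y) : y ∈ Subgroup.normalizer (A : Set G) := by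
  have hinf : Subgroup.zpowers y ⊓ P = ⊥ := by
    refine (Subgroup.eq_bot_iff_forall _).2 ?_
    rintro z ⟨⟨n, rfl⟩, hzP⟩
    exact (hy.zpow n).eq_one_of_ne hq hp hqp (isPGroup_iff_forall_isPElement.1 hP _ hzP)
  have hmod : A = (A ⊔ Subgroup.zpowers y) ⊓ P := by
    rw [← (hG.isSigmaQuasinormal_of_le hp hP hA).2.2 _ P hA, hinf, sup_bot_eq]
  rw [hmod]
  refine Subgroup.inf_normalizer_le_normalizer_inf ⟨?_, ?_⟩
  · exact Subgroup.le_normalizer (Subgroup.mem_sup_right (Subgroup.mem_zpowers y))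
  · exact Subgroup.normalizer_eq_top P ▸ Subgroup.mem_top y

lemma isPowerAutomorphism_conjNormal [Finite G] [P.Normal]
    (h : ∀ A ≤ P, y ∈ Subgroup.normalizer (A : Set G)) :
    IsPowerAutomorphism (MulAut.conjNormal y : MulAut P) := by
  intro H
  refine Subgroup.eq_of_le_of_card_ge ?_
    (Subgroup.card_map_of_injective (MulAut.conjNormal y).injective).ge
  rintro _ ⟨x, hx, rfl⟩
  have hmem := (Subgroup.mem_normalizer_iff.1 (h (H.map P.subtype) (Subgroup.map_subtype_le H))
    x).1 (Subgroup.mem_map_of_mem P.subtype hx)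
  rwa [← MulAut.conjNormal_apply, ← P.coe_subtype,
    Subgroup.mem_map_iff_mem P.subtype_injective] at hmem

lemma IsMSigmaTGroup.isPowerAutomorphism_conjNormal [Finite G] (hG : IsMSigmaTGroup σ G)
    (hp : p.Prime) (hq : q.Prime) (hqp : q ≠ p) [P.Normal] (hP : IsPGroup p P)
    (hy : IsPElement q y) : IsPowerAutomorphism (MulAut.conjNormal y : MulAut P) :=
  SigmaGroup.isPowerAutomorphism_conjNormal fun _ hA => hG.mem_normalizer hp hq hqp hP hA hy

lemma conjNormal_eq_one_iff [P.Normal] :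
    (MulAut.conjNormal y : MulAut P) = 1 ↔ y ∈ Subgroup.centralizer (P : Set G) := by
  simp only [DFunLike.ext_iff, Subtype.forall, Subtype.ext_iff, MulAut.conjNormal_apply,
    MulAut.one_apply, mul_inv_eq_iff_eq_mul, Subgroup.mem_centralizer_iff, SetLike.mem_coe]
  exact forall₂_congr fun _ _ => eq_comm

lemma normal_of_sylow_le_normalizer [Finite G] [Fact p.Prime] (S : Sylow p G)
    (hS : (S : Subgroup G) ≤ Subgroup.normalizer (A : Set G))
    (h : ∀ q : ℕ, q.Prime → q ≠ p → ∀ z : G, IsPElement q z →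
      z ∈ Subgroup.normalizer (A : Set G)) : A.Normal := by
  rw [← Subgroup.normalizer_eq_top_iff, ← Subgroup.index_eq_one]
  by_contra hne
  obtain ⟨q, hq, hqd⟩ := Nat.exists_prime_and_dvd hne
  rcases eq_or_ne q p with rfl | hqp
  · exact S.not_dvd_index (hqd.trans (Subgroup.index_dvd_of_le hS))
  · exact not_dvd_index_of_forall_isPElement hq (h q hq hqp) hqd

lemma exists_ne_one_sylow_le_centralizer [Finite G] [Fact p.Prime] (S : Sylow p G) [P.Normal]
    (hPb : P ≠ ⊥) (hP : IsPGroup p P) :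
    ∃ w ∈ P, w ≠ 1 ∧ (S : Subgroup G) ≤ Subgroup.centralizer {w} := by
  let φ : S →* MulAut P := MulAut.conjNormal.comp (S : Subgroup G).subtype
  let _ : MulAction S P := MulAction.compHom P φ
  have hd : p ∣ Nat.card P := by
    obtain ⟨n, hn⟩ := IsPGroup.iff_card.1 hP
    rw [hn]
    exact dvd_pow_self p fun h0 => hPb (Subgroup.card_eq_one.1 (by rw [hn, h0, pow_zero]))
  obtain ⟨w, hw, hw1⟩ := S.isPGroup'.exists_fixed_point_of_prime_dvd_card_of_fixed_point P hd
    (a := 1) fun s => map_one (φ s)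
  refine ⟨w, w.2, fun h => hw1 (Subtype.ext h.symm), fun s hs => ?_⟩
  rw [Subgroup.mem_centralizer_singleton_iff, ← mul_inv_eq_iff_eq_mul]
  exact congrArg Subtype.val (hw ⟨s, hs⟩)

lemma exists_normal_isPGroup (G : Type*) [Group G] [Finite G] [Nontrivial G]
    [Group.IsSolvable G] :
    ∃ p : ℕ, p.Prime ∧ ∃ P : Subgroup G, P.Normal ∧ P ≠ ⊥ ∧ IsPGroup p P := by
  obtain ⟨N, hNn, hN, hNc, -⟩ := exists_minimal_normal G
  obtain ⟨p, hp, hpN⟩ := Nat.exists_prime_and_dvd (mt Subgroup.card_eq_one.1 hN)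
  have := Fact.mk hp
  refine ⟨p, hp, piClosure {p} N, inferInstance, ?_, ?_⟩
  · obtain ⟨x, hx⟩ := exists_prime_orderOf_dvd_card' p hpN
    have hxp : IsPElement p (x : G) :=
      ⟨1, by rw [pow_one, ← hx, ← Subgroup.orderOf_coe, pow_orderOf_eq_one]⟩
    intro hbot
    have hx1 : (x : G) = 1 := Subgroup.mem_bot.1 (hbot ▸ hxp.mem_piClosure hp rfl x.2)
    rw [← Subgroup.orderOf_coe, hx1, orderOf_one] at hx
    exact hp.ne_one hx.symm
  · have hpi : IsPiGroup {p} (piClosure {p} N) := isPiGroup_piClosure <|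
      piClosure_le.trans (hNc.trans (Subgroup.centralizer_le piClosure_le))
    exact .of_card (Nat.eq_prime_pow_of_unique_prime_dvd Nat.card_pos.ne' (hpi _ · ·))

lemma IsMSigmaTGroup.exists_normal_card_prime [Finite G] [Nontrivial G] [Group.IsSolvable G]
    (hG : IsMSigmaTGroup σ G) : ∃ W : Subgroup G, W.Normal ∧ (Nat.card W).Prime := by
  obtain ⟨p, hp, P, hPn, hPb, hP⟩ := exists_normal_isPGroup G
  have := Fact.mk hp
  obtain ⟨S⟩ : Nonempty (Sylow p G) := inferInstance
  obtain ⟨w, hwP, hw1, hSw⟩ := exists_ne_one_sylow_le_centralizer S hPb hP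
  obtain ⟨n, hn⟩ := (isPGroup_iff_forall_isPElement.1 hP w hwP).exists_orderOf_pow_eq hp hw1
  refine ⟨Subgroup.zpowers (w ^ n), normal_of_sylow_le_normalizer S ?_ fun q hq hqp z hz =>
    hG.mem_normalizer hp hq hqp hP (Subgroup.zpowers_le.2 (P.pow_mem hwP n)) hz, ?_⟩
  · refine le_trans (fun s hs => ?_) (Subgroup.centralizer_le_normalizer _)
    rintro _ ⟨k, rfl⟩
    have hc : Commute w s := (Subgroup.mem_centralizer_singleton_iff.1 (hSw hs)).symm
    exact (hc.pow_left n).zpow_left k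
  · rwa [Nat.card_zpowers, hn]

-- `|Aut P| = |P| - 1` is prime to `p`.
lemma IsPElement.mem_centralizer_of_card_lt [Finite G] [P.Normal] (hy : IsPElement p y)
    (hp : p.Prime) (hP : (Nat.card P).Prime) (hlt : Nat.card P < p) :
    y ∈ Subgroup.centralizer (P : Set G) := by
  have := Fact.mk hP
  have : IsCyclic P := isCyclic_of_prime_card rfl
  refine conjNormal_eq_one_iff.1 <| (hy.map (MulAut.conjNormal (H := P))).eq_one_of_not_dvd_card hp
    (Subgroup.mem_top _) fun hd => ?_
  rw [Subgroup.card_top, IsCyclic.card_mulAut, Nat.totient_prime hP] at hd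
  exact absurd (Nat.le_of_dvd (Nat.sub_pos_of_lt hP.one_lt) hd) (by omega)

lemma normal_of_normal_sup {S W : Subgroup G} (hS : IsPGroup p S) [W.Normal]
    (hW : (Nat.card W).Coprime p) (hSW : S ≤ Subgroup.centralizer (W : Set G))
    (h : (S ⊔ W).Normal) : S.Normal := by
  refine ⟨fun s hs g => ?_⟩
  have hSel := isPGroup_iff_forall_isPElement.1 hS
  obtain ⟨t, ht, w, hw, htw⟩ := Subgroup.mem_sup_of_normal_right.1
    (h.conj_mem s (Subgroup.mem_sup_left hs) g)
  have hw1 : w = 1 := (hSel t ht).eq_one_of_mul (htw ▸ (hSel s hs).conj g)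
    (hSW ht w hw).symm hW (pow_card_eq_one_of_mem hw)
  rw [← htw, hw1, mul_one]
  exact ht

theorem IsMSigmaTGroup.sylow_normal_of_max_prime {G : Type*} [Group G] [Finite G]
    [Group.IsSolvable G] (hG : IsMSigmaTGroup σ G) [hp : Fact p.Prime]
    (hmax : ∀ q : ℕ, q.Prime → q ∣ Nat.card G → q ≤ p) (S : Sylow p G) :
    (S : Subgroup G).Normal := by
  induction hn : Nat.card G using Nat.strong_induction_on generalizing G with
  | _ n ih =>
  subst hn
  cases subsingleton_or_nontrivial G
  · rw [Subsingleton.elim (S : Subgroup G) ⊤]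
    infer_instance
  obtain ⟨W, hWn, hW⟩ := hG.exists_normal_card_prime
  have hsurj := QuotientGroup.mk'_surjective W
  have hSW : ((S : Subgroup G) ⊔ W).Normal := by
    have hquot := (ih _ (card_quotient_lt (isAtom_iff_card_prime.2 hW).1) (hG.of_surjective hsurj)
      (fun q hq hd => hmax q hq (hd.trans W.card_quotient_dvd_card)) (S.mapSurjective hsurj)
      rfl).comap (QuotientGroup.mk' W)
    rwa [Sylow.coe_mapSurjective, Subgroup.comap_map_eq, QuotientGroup.ker_mk'] at hquot
  rcases (hmax _ hW W.card_subgroup_dvd_card).eq_or_lt with hWp | hWp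
  · have hWS : W ≤ S := IsPGroup.le_sylow_of_normal (.of_card (n := 1) (by rw [hWp, pow_one])) S
    rwa [sup_eq_left.2 hWS] at hSW
  · exact normal_of_normal_sup S.isPGroup' ((Nat.coprime_primes hW hp.out).2 hWp.ne)
      (fun s hs => (isPGroup_iff_forall_isPElement.1 S.isPGroup' s hs).mem_centralizer_of_card_lt
        hp.out hW hWp) hSW

end NormalPSubgroups

/-! ### The `σ`-nilpotent residual of a soluble `MσT`-group -/

section ResidualConditions

variable {ι : Type*} {σ : ι → Set ℕ} {G : Type*} [Group G] {p : ℕ} {i : ι} {x : G}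
  {A B D E P : Subgroup G}

lemma le_centralizer_of_map_mk [P.Normal] [D.Normal] (hDP : D ⊓ P = ⊥) (hB : B ≤ D)
    (h : A.map (QuotientGroup.mk' P) ≤
      Subgroup.centralizer (B.map (QuotientGroup.mk' P) : Set (G ⧸ P))) :
    A ≤ Subgroup.centralizer (B : Set G) := by
  intro a ha
  refine Subgroup.mem_centralizer_iff.2 fun b hb => ?_
  have hP : ⁅b, a⁆ ∈ P := by
    rw [← QuotientGroup.ker_mk' P, MonoidHom.mem_ker, map_commutatorElement]
    exact commutatorElement_eq_one_iff_mul_comm.2 <| Subgroup.mem_centralizer_iff.1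
      (h (Subgroup.mem_map_of_mem _ ha)) _ (Subgroup.mem_map_of_mem _ hb)
  have hD : ⁅b, a⁆ ∈ D := commutatorElement_mem_of_mem_normalizer (hB hb)
    (Subgroup.normalizer_eq_top D ▸ Subgroup.mem_top a)
  exact commutatorElement_eq_one_iff_mul_comm.1 (Subgroup.mem_bot.1 (hDP ▸ ⟨hD, hP⟩))

lemma normal_of_map_mk [P.Normal] [D.Normal] (hDP : D ⊓ P = ⊥) (hB : B ≤ D)
    (h : (B.map (QuotientGroup.mk' P)).Normal) : B.Normal := by
  have hPB : (P ⊔ B).Normal := QuotientGroup.comap_map_mk' P B ▸ h.comap _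
  have hBD : (P ⊔ B) ⊓ D = B := by
    rw [sup_comm, ← (isModularSubgroup_of_normal P).1 B D hB, inf_comm P, hDP, sup_bot_eq]
  exact hBD ▸ Subgroup.normal_inf_normal (P ⊔ B) D

lemma card_map_mk [P.Normal] (hDP : D ⊓ P = ⊥) :
    Nat.card (D.map (QuotientGroup.mk' P)) = Nat.card D := by
  rw [← Subgroup.relIndex_ker, QuotientGroup.ker_mk', ← Subgroup.inf_relIndex_left,
    hDP, Subgroup.relIndex_bot_left]

lemma isHallSubgroup_of_map_mk [P.Normal] [D.Normal] (hP : IsHallSubgroup P) (hDP : D ⊓ P = ⊥)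
    (h : IsHallSubgroup (D.map (QuotientGroup.mk' P))) : IsHallSubgroup D := by
  have hcop : (Nat.card D).Coprime (Nat.card P) := by
    refine (Nat.Coprime.of_dvd_right ?_ hP).symm
    rw [← card_map_mk hDP]
    exact Subgroup.card_subgroup_dvd_card _
  have hindex : D.relIndex P * (D.map (QuotientGroup.mk' P)).index = D.index := by
    rw [Subgroup.index_map, QuotientGroup.ker_mk', QuotientGroup.range_mk', Subgroup.index_top,
      mul_one, sup_comm, ← Subgroup.relIndex_sup_right,
      Subgroup.relIndex_mul_index le_sup_right]
  rw [IsHallSubgroup, ← hindex]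
  exact (hcop.of_dvd_right (Subgroup.relIndex_dvd_card D P)).mul_right (card_map_mk hDP ▸ h)

lemma card_sup_dvd_mul (A B : Subgroup G) [B.Normal] :
    Nat.card (A ⊔ B : Subgroup G) ∣ Nat.card B * Nat.card A := by
  have h : Nat.card B * B.relIndex (A ⊔ B) = Nat.card (A ⊔ B : Subgroup G) := by
    rw [← Subgroup.relIndex_bot_left, ← Subgroup.relIndex_bot_left]
    exact Subgroup.relIndex_mul_relIndex _ _ _ bot_le le_sup_right
  rw [← h, Subgroup.relIndex_sup_right]
  exact mul_dvd_mul_left _ (Subgroup.relIndex_dvd_card B A)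

lemma isHallSubgroup_of_isPGroup [Finite G] (hp : p.Prime) (hP : IsPGroup p P)
    (hidx : ¬ p ∣ P.index) : IsHallSubgroup P := by
  have := Fact.mk hp
  obtain ⟨n, hn⟩ := IsPGroup.iff_card.1 hP
  rw [IsHallSubgroup, hn]
  exact (hp.coprime_iff_not_dvd.2 hidx).pow_left n

lemma IsHallSubgroup.mem_of_dvd_card (hA : IsHallSubgroup A) [A.Normal] (hp : p.Prime)
    (hpA : p ∣ Nat.card A) (hx : IsPElement p x) : x ∈ A :=
  hx.mem_of_not_dvd_index hp fun h => Nat.not_coprime_of_dvd_of_dvd hp.one_lt hpA h hA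

lemma IsHallSubgroup.sup (hA : IsHallSubgroup A) (hB : IsHallSubgroup B) [B.Normal] :
    IsHallSubgroup (A ⊔ B) := by
  refine Nat.Coprime.of_dvd_left (card_sup_dvd_mul A B) (Nat.Coprime.mul_left ?_ ?_)
  · exact Nat.Coprime.of_dvd_right (Subgroup.index_dvd_of_le le_sup_right) hB
  · exact Nat.Coprime.of_dvd_right (Subgroup.index_dvd_of_le le_sup_left) hA

lemma IsPElement.mem_or_mem_of_mem_sup (hx : IsPElement p x) (hp : p.Prime) [A.Normal] [B.Normal]
    (hA : IsHallSubgroup A) (hB : IsHallSubgroup B) (hxAB : x ∈ A ⊔ B) : x ∈ A ∨ x ∈ B := by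
  by_cases h : p ∣ Nat.card (A ⊔ B : Subgroup G)
  · exact ((hp.dvd_mul.1 (h.trans (card_sup_dvd_mul A B))).imp
      (hB.mem_of_dvd_card hp · hx) (hA.mem_of_dvd_card hp · hx)).symm
  · exact Or.inl (hx.eq_one_of_not_dvd_card hp hxAB h ▸ A.one_mem)

/-- The properties of a subgroup `D` of `G` which, for the `σ`-nilpotent residual of a soluble
`MσT`-group, are established by induction on the order of the group. The last two fields are
intrinsic forms of the conditions on power automorphisms and on Hall `σ i`-subgroups. -/
structure ResidualConditions (σ : ι → Set ℕ) (D : Subgroup G) : Prop where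
  comm : IsMulCommutative D
  hall : IsHallSubgroup D
  odd : Odd (Nat.card D)
  normal_of_le : ∀ E ≤ D, E.Normal
  le_centralizer : ∀ i, piClosure (σ i) (⊤ : Subgroup G) ≤
    Subgroup.centralizer (piClosure (σ i) D : Set G)

lemma residualConditions_bot : ResidualConditions σ (⊥ : Subgroup G) where
  comm := inferInstance
  hall := by
    rw [IsHallSubgroup, Subgroup.card_bot]
    exact Nat.coprime_one_left _
  odd := Subgroup.card_bot (G := G) ▸ odd_one
  normal_of_le E hE := le_bot_iff.1 hE ▸ inferInstance
  le_centralizer i := Subgroup.le_centralizer_iff.1 (piClosure_le.trans bot_le)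

lemma ResidualConditions.of_map_mk [Finite G] [P.Normal] [D.Normal] (hP : IsHallSubgroup P)
    (hDP : D ⊓ P = ⊥) (h : ResidualConditions σ (D.map (QuotientGroup.mk' P))) :
    ResidualConditions σ D where
  comm := Subgroup.le_centralizer_iff_isMulCommutative.1 <| le_centralizer_of_map_mk hDP le_rfl <|
    Subgroup.le_centralizer_iff_isMulCommutative.2 h.comm
  hall := isHallSubgroup_of_map_mk hP hDP h.hall
  odd := card_map_mk hDP ▸ h.odd
  normal_of_le E hE := normal_of_map_mk hDP hE (h.normal_of_le _ (Subgroup.map_mono hE))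
  le_centralizer i := by
    refine le_centralizer_of_map_mk hDP piClosure_le ?_
    rw [map_piClosure, map_piClosure,
      Subgroup.map_top_of_surjective _ (QuotientGroup.mk'_surjective P)]
    exact h.le_centralizer i

lemma ResidualConditions.sup [Finite G] (hA : ResidualConditions σ A)
    (hB : ResidualConditions σ B) (hAB : A ≤ Subgroup.centralizer (B : Set G)) :
    ResidualConditions σ (A ⊔ B) := by
  have hAn := hA.normal_of_le A le_rfl
  have hBn := hB.normal_of_le B le_rfl
  have hmem {q : ℕ} (hq : q.Prime) {x : G} (hx : IsPElement q x) (hxAB : x ∈ A ⊔ B) :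
      x ∈ A ∨ x ∈ B := hx.mem_or_mem_of_mem_sup hq hA.hall hB.hall hxAB
  refine ⟨?_, hA.hall.sup hB.hall, ?_, fun E hE => ?_, fun i => ?_⟩
  · have hA' := Subgroup.le_centralizer_iff_isMulCommutative.2 hA.comm
    have hB' := Subgroup.le_centralizer_iff_isMulCommutative.2 hB.comm
    exact Subgroup.le_centralizer_iff_isMulCommutative.1 <| sup_le
      (Subgroup.le_centralizer_iff.1 (sup_le hA' (Subgroup.le_centralizer_iff.1 hAB)))
      (Subgroup.le_centralizer_iff.1 (sup_le hAB hB'))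
  · exact (hB.odd.mul hA.odd).of_dvd_nat (card_sup_dvd_mul A B)
  · have hEAB : E ⊓ A ⊔ E ⊓ B = E := by
      refine (sup_le inf_le_left inf_le_left).antisymm
        (le_of_forall_isPElement fun q hq x hxE hx => ?_)
      exact (hmem hq hx (hE hxE)).elim (fun h => Subgroup.mem_sup_left ⟨hxE, h⟩)
        (fun h => Subgroup.mem_sup_right ⟨hxE, h⟩)
    have := hA.normal_of_le (E ⊓ A) inf_le_right
    have := hB.normal_of_le (E ⊓ B) inf_le_right
    exact hEAB ▸ Subgroup.sup_normal _ _
  · refine piClosure_le_centralizer_iff.2 fun q r hq hr hqi hri x hx y hy hxq hyr => ?_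
    have key {C : Subgroup G} (hC : ResidualConditions σ C) (hyC : y ∈ C) : Commute x y :=
      piClosure_le_centralizer_iff.1 (hC.le_centralizer i) q r hq hr hqi hri x hx y hyC hxq hyr
    exact (hmem hr hyr hy).elim (key hA) (key hB)

end ResidualConditions

section NormalSylow

variable {ι : Type*} {σ : ι → Set ℕ} {G : Type*} [Group G] {p : ℕ} {i : ι}
  {A P : Subgroup G}

lemma le_piClosure_sup [Finite G] [P.Normal] (hp : p.Prime) (hidx : ¬ p ∣ P.index)
    (A : Subgroup G) : A ≤ piClosure {p}ᶜ A ⊔ P :=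
  le_of_forall_isPElement fun q hq x hxA hx => by
    by_cases hqp : q = p
    · exact Subgroup.mem_sup_right ((hqp ▸ hx).mem_of_not_dvd_index hp hidx)
    · exact Subgroup.mem_sup_left (hx.mem_piClosure hq hqp hxA)

lemma piClosure_singleton_le [P.Normal] (hidx : ¬ p ∣ P.index) : piClosure {p} A ≤ P :=
  piClosure_le_iff.2 fun _ hq hqp _ _ hx => by
    rw [Set.mem_singleton_iff.1 hqp] at hq hx
    exact hx.mem_of_not_dvd_index hq hidx

lemma disjoint_piClosure [Finite G] [P.Normal] (hP : IsPGroup p P) (hp : p.Prime)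
    (hidx : ¬ p ∣ P.index) (h : piClosure {p}ᶜ A ≤ Subgroup.centralizer (P : Set G)) :
    piClosure {p}ᶜ A ⊓ P = ⊥ := by
  have hpi : IsPiGroup {p}ᶜ (piClosure {p}ᶜ A) := isPiGroup_piClosure <|
    h.trans <| Subgroup.centralizer_le <| by rw [compl_compl]; exact piClosure_singleton_le hidx
  refine (Subgroup.eq_bot_iff_forall _).2 fun x hx => ?_
  exact (isPGroup_iff_forall_isPElement.1 hP x hx.2).eq_one_of_not_dvd_card hp hx.1
    fun hd => hpi p hp hd rfl

lemma sigmaResidual_le_piClosure [Finite G] (hσ : IsPrimePartition σ) (hp : p.Prime)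
    (hpi : p ∈ σ i) [P.Normal] (hP : IsPGroup p P) (hidx : ¬ p ∣ P.index)
    (hout : piClosure (σ i)ᶜ (⊤ : Subgroup G) ≤ Subgroup.centralizer (P : Set G)) :
    sigmaResidual σ G ≤ piClosure {p}ᶜ (sigmaResidual σ G) := by
  set L := piClosure {p}ᶜ (sigmaResidual σ G)
  -- Modulo `L` the commutator lies in the image of `P`, so `x` commutes with it.
  have key (r : ℕ) (hr : r.Prime) (hri : r ∉ σ i) (x y : G) (hx : IsPElement r x)
      (hxy : ⁅x, y⁆ ∈ sigmaResidual σ G) : ⁅x, y⁆ ∈ L := by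
    obtain ⟨l, hl, u, hu, hlu⟩ := Subgroup.mem_sup_of_normal_right.1
      (le_piClosure_sup hp hidx _ hxy)
    have hmk : ⁅QuotientGroup.mk' L x, QuotientGroup.mk' L y⁆ = QuotientGroup.mk' L u := by
      rw [← map_commutatorElement, ← hlu, map_mul,
        show QuotientGroup.mk' L l = 1 from (QuotientGroup.eq_one_iff l).2 hl, one_mul]
    have hxu : Commute x u := (Subgroup.mem_centralizer_iff.1
      (hout (hx.mem_piClosure hr hri trivial)) u hu).symm
    obtain ⟨k, hk⟩ := isPGroup_iff_forall_isPElement.1 hP u hu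
    have hpr : (p ^ k).Coprime r := ((Nat.coprime_primes hp hr).2 fun h => hri (h ▸ hpi)).pow_left k
    have hcomm := (hx.map (QuotientGroup.mk' L)).commute_of_commute_commutatorElement
      (d := QuotientGroup.mk' L y) hpr (hmk ▸ hxu.map _) (by rw [hmk, ← map_pow, hk, map_one])
    rwa [← commutatorElement_eq_one_iff_commute, ← map_commutatorElement, ← MonoidHom.mem_ker,
      QuotientGroup.ker_mk'] at hcomm
  refine sigmaResidual_le L ((isSigmaNilpotent_quotient_iff hσ L).2 ?_)
  intro j r s hr hs hrj hsj x y hx hy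
  have hxy := commutatorElement_mem_sigmaResidual hσ hr hs hrj hsj hx hy
  by_cases hri : r ∈ σ i
  · rw [← commutatorElement_inv] at hxy ⊢
    exact inv_mem (key s hs (hσ.eq_of_mem hri hrj ▸ hsj) y x hy (inv_mem_iff.1 hxy))
  · exact key r hr hri x y hx hxy

end NormalSylow

section SylowAction

variable {ι : Type*} {σ : ι → Set ℕ} {G : Type*} [Group G] {p q : ℕ} {i : ι} {x y u : G}
  {D P : Subgroup G}

lemma orderOf_conjNormal_coprime [P.Normal] (hp : p.Prime) (hq : q.Prime) (hqp : q ≠ p)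
    (hy : IsPElement q y) : (orderOf (MulAut.conjNormal y : MulAut P)).Coprime p :=
  (hy.map (MulAut.conjNormal : G →* MulAut P)).orderOf_coprime hp hq hqp

lemma exists_commutatorElement_eq [Finite G] [P.Normal] (hp : p.Prime) (hq : q.Prime)
    (hqp : q ≠ p) (hP : IsPGroup p P) (hy : IsPElement q y)
    (hα : IsPowerAutomorphism (MulAut.conjNormal y : MulAut P))
    (hyP : y ∉ Subgroup.centralizer (P : Set G)) (hu : u ∈ P) : ∃ v ∈ P, ⁅v, y⁆ = u := by
  set α : MulAut P := MulAut.conjNormal y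
  -- A nontrivial power automorphism of order prime to `p` fixes only `1`.
  have hfix (z : P) (hz : α z = z) : z = 1 := by
    by_contra hz1
    refine hyP (conjNormal_eq_one_iff.1 ?_)
    exact hα.eq_one_of_apply_eq_zpow hp hP (orderOf_conjNormal_coprime hp hq hqp hy) hz1
      (k := 1) (by rw [zpow_one, hz]) Int.cast_one
  have hinj : Function.Injective fun v : P => v * (α v)⁻¹ := by
    intro v w hvw
    have hvw' : α (w⁻¹ * v) = w⁻¹ * v := by
      have hv : v = w * (α w)⁻¹ * α v := mul_inv_eq_iff_eq_mul.1 hvw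
      rw [map_mul, map_inv, eq_inv_mul_iff_mul_eq, ← mul_assoc, ← hv]
    exact (inv_mul_eq_one.1 (hfix _ hvw')).symm
  obtain ⟨v, hv⟩ := Finite.surjective_of_injective hinj ⟨u, hu⟩
  refine ⟨v, v.2, (?_ : ⁅(v : G), y⁆ = ((⟨u, hu⟩ : P) : G))⟩
  rw [← hv, Subgroup.coe_mul, Subgroup.coe_inv, MulAut.conjNormal_apply, commutatorElement_def]
  group

lemma commutatorElement_mem_centralizer (hn : ∀ E ≤ P, E.Normal) (g h : G) :
    ⁅g, h⁆ ∈ Subgroup.centralizer (P : Set G) := by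
  refine Subgroup.mem_centralizer_iff.2 fun u hu => ?_
  have := hn (Subgroup.zpowers u) (Subgroup.zpowers_le.2 hu)
  -- The automorphism group of the cyclic group `⟨u⟩` is commutative.
  have hcomm : ⁅g, h⁆ ∈ Subgroup.centralizer (Subgroup.zpowers u : Set G) := by
    rw [← conjNormal_eq_one_iff, map_commutatorElement, commutatorElement_eq_one_iff_mul_comm]
    apply (IsCyclic.mulAutMulEquiv (Subgroup.zpowers u)).injective
    rw [map_mul, map_mul, mul_comm]
  exact Subgroup.mem_centralizer_iff.1 hcomm u (Subgroup.mem_zpowers u)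

lemma sigmaResidual_le_centralizer [Finite G] (hσ : IsPrimePartition σ) [P.Normal]
    (hn : ∀ E ≤ P, E.Normal) : sigmaResidual σ G ≤ Subgroup.centralizer (P : Set G) :=
  sigmaResidual_le _ <| (isSigmaNilpotent_quotient_iff hσ _).2
    fun _ _ _ _ _ _ _ x y _ _ => commutatorElement_mem_centralizer hn x y

lemma IsMSigmaTGroup.isMulCommutative [Finite G] (hG : IsMSigmaTGroup σ G) (hp : p.Prime)
    (hq : q.Prime) (hqp : q ≠ p) [P.Normal] (hP : IsPGroup p P) (hy : IsPElement q y)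
    (hyP : y ∉ Subgroup.centralizer (P : Set G)) : IsMulCommutative P :=
  (hG.isPowerAutomorphism_conjNormal hp hq hqp hP hy).isMulCommutative hp hP
    (orderOf_conjNormal_coprime hp hq hqp hy) fun h => hyP (conjNormal_eq_one_iff.1 h)

lemma IsMSigmaTGroup.normal_of_le [Finite G] (hG : IsMSigmaTGroup σ G) (hp : p.Prime)
    [P.Normal] [IsMulCommutative P] (hP : IsPGroup p P) (hidx : ¬ p ∣ P.index) {E : Subgroup G}
    (hE : E ≤ P) : E.Normal := by
  have := Fact.mk hp
  refine normal_of_sylow_le_normalizer (hP.toSylow hidx) ?_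
    fun q hq hqp z hz => hG.mem_normalizer hp hq hqp hP hE hz
  exact (Subgroup.le_centralizer P).trans <|
    (Subgroup.centralizer_le hE).trans (Subgroup.centralizer_le_normalizer _)

lemma IsMSigmaTGroup.le_sigmaResidual [Finite G] (hσ : IsPrimePartition σ)
    (hG : IsMSigmaTGroup σ G) (hp : p.Prime) (hq : q.Prime) (hpi : p ∈ σ i) (hqi : q ∉ σ i)
    [P.Normal] (hP : IsPGroup p P) (hy : IsPElement q y)
    (hyP : y ∉ Subgroup.centralizer (P : Set G)) : P ≤ sigmaResidual σ G := by
  intro u hu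
  have hqp : q ≠ p := fun h => hqi (h ▸ hpi)
  obtain ⟨v, hv, rfl⟩ := exists_commutatorElement_eq hp hq hqp hP hy
    (hG.isPowerAutomorphism_conjNormal hp hq hqp hP hy) hyP hu
  exact commutatorElement_mem_sigmaResidual hσ hp hq hpi hqi
    (isPGroup_iff_forall_isPElement.1 hP v hv) hy

lemma residualConditions_of_isPGroup [Finite G] (hσ : IsPrimePartition σ) (hp : p.Prime)
    (hp2 : p ≠ 2) (hpi : p ∈ σ i) [IsMulCommutative P] (hP : IsPGroup p P)
    (hidx : ¬ p ∣ P.index) (hn : ∀ E ≤ P, E.Normal)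
    (hcen : piClosure (σ i) (⊤ : Subgroup G) ≤ Subgroup.centralizer (P : Set G)) :
    ResidualConditions σ P where
  comm := inferInstance
  hall := isHallSubgroup_of_isPGroup hp hP hidx
  odd := by
    have := Fact.mk hp
    obtain ⟨n, hn⟩ := IsPGroup.iff_card.1 hP
    exact hn ▸ (hp.odd_of_ne_two hp2).pow
  normal_of_le := hn
  le_centralizer j := by
    refine piClosure_le_centralizer_iff.2 fun r s hr hs hrj hsj x _ y hyP hx hy => ?_
    by_cases hsp : s = p
    · have hrj' : r ∈ σ i := hσ.eq_of_mem hpi (hsp ▸ hsj) ▸ hrj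
      exact (Subgroup.mem_centralizer_iff.1 (hcen (hx.mem_piClosure hr hrj' trivial)) y hyP).symm
    · rw [hy.eq_one_of_ne hs hp hsp (isPGroup_iff_forall_isPElement.1 hP y hyP)]
      exact Commute.one_right x

lemma ResidualConditions.of_map_mk_of_le [Finite G] (hp : p.Prime) [D.Normal] [P.Normal]
    (hP : IsPGroup p P) (hidx : ¬ p ∣ P.index) (hPD : P ≤ D)
    (hcen : D ≤ Subgroup.centralizer (P : Set G)) (hRP : ResidualConditions σ P)
    (hRD : ResidualConditions σ (D.map (QuotientGroup.mk' P))) : ResidualConditions σ D := by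
  set L := piClosure {p}ᶜ D
  have hLP : L ⊓ P = ⊥ := disjoint_piClosure hP hp hidx (piClosure_le.trans hcen)
  have hsup : L ⊔ P = D := (sup_le piClosure_le hPD).antisymm (le_piClosure_sup hp hidx D)
  have hmap : L.map (QuotientGroup.mk' P) = D.map (QuotientGroup.mk' P) := by
    rw [← hsup, Subgroup.map_sup, QuotientGroup.map_mk'_self, sup_bot_eq]
  have hRL : ResidualConditions σ L := .of_map_mk hRP.hall hLP (hmap ▸ hRD)
  exact hsup ▸ hRL.sup hRP (piClosure_le.trans hcen)

end SylowAction

section SelfCentralizing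

variable {ι : Type*} {σ : ι → Set ℕ} {G : Type*} [Group G] {p q s t : ℕ} {i : ι} {x y u : G}
  {A D P Q : Subgroup G}

lemma isAtom_of_card_dvd_mul [Finite G] (hp : p.Prime) (hq : q.Prime) (h : Nat.card G ∣ p * q)
    (hb : A ≠ ⊥) (ht : A ≠ ⊤) : IsAtom A := by
  refine isAtom_iff_card_prime.2 ?_
  obtain ⟨a, b, ha, hb', hab⟩ := Nat.dvd_mul.1 (A.card_subgroup_dvd_card.trans h)
  rcases (Nat.dvd_prime hp).1 ha with rfl | rfl <;> rcases (Nat.dvd_prime hq).1 hb' with rfl | rfl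
  · exact absurd (Subgroup.card_eq_one.1 hab.symm) hb
  · rwa [← hab, one_mul]
  · rwa [← hab, mul_one]
  · exact absurd (Subgroup.eq_top_of_card_eq A
      (Nat.dvd_antisymm A.card_subgroup_dvd_card (hab ▸ h))) ht

lemma isModularLattice_of_card_dvd_mul [Finite G] (hp : p.Prime) (hq : q.Prime)
    (h : Nat.card G ∣ p * q) : IsModularLattice (Subgroup G) := by
  refine ⟨fun {X} Y Z hXZ => ?_⟩
  by_cases hX : X = ⊥
  · simp only [hX, bot_sup_eq, le_refl]
  by_cases hZ : Z = ⊤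
  · simp only [hZ, inf_top_eq, le_refl]
  have hZ_atom := isAtom_of_card_dvd_mul hp hq h (ne_bot_of_le_ne_bot hX hXZ) hZ
  rw [(hZ_atom.le_iff_eq hX).1 hXZ]
  exact inf_le_right.trans le_sup_left

lemma IsMSigmaTGroup.isSigmaQuasinormal_of_normal_sup [Finite G] (hG : IsMSigmaTGroup σ G)
    (hpi : p ∈ σ i) (hsi : s ∈ σ i) (hp : p.Prime) (hs : s.Prime) [P.Normal]
    (hP : Nat.card P = p) (hA : Nat.card A = s) (hAP : (A ⊔ P).Normal) :
    IsSigmaQuasinormal σ A := by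
  have hcard : Nat.card (A ⊔ P : Subgroup G) ∣ p * s := by
    simpa only [hP, hA] using card_sup_dvd_mul A P
  refine hG.trans le_sup_left ⟨?_, ?_⟩ (isSigmaQuasinormal_of_normal (A ⊔ P))
  · refine Relation.ReflTransGen.single ⟨le_top, Or.inr ⟨i, fun q hq hqd => ?_⟩⟩
    have hdvd := (hqd.trans (Subgroup.card_quotient_dvd_card _)).trans
      (Subgroup.card_top (G := (A ⊔ P : Subgroup G)) ▸ hcard)
    rcases hq.dvd_mul.1 hdvd with h | h
    · exact (Nat.prime_dvd_prime_iff_eq hq hp).1 h ▸ hpi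
    · exact (Nat.prime_dvd_prime_iff_eq hq hs).1 h ▸ hsi
  · exact isModularLattice_iff_forall_isModularSubgroup.1
      (isModularLattice_of_card_dvd_mul hp hs hcard) _

lemma commutatorElement_mem_of_mem_normal [P.Normal] (hu : u ∈ P) (x : G) : ⁅u, x⁆ ∈ P :=
  Subgroup.commutator_le_left P ⊤ (Subgroup.commutator_mem_commutator hu trivial)

lemma zpowers_eq_of_isAtom (hP : IsAtom P) (hu : u ∈ P) (hu1 : u ≠ 1) :
    Subgroup.zpowers u = P :=
  (hP.le_iff_eq (mt Subgroup.zpowers_eq_bot.1 hu1)).1 (Subgroup.zpowers_le.2 hu)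

lemma map_conj_inf_eq_bot [P.Normal] (hP : IsAtom P)
    (hPC : Subgroup.centralizer (P : Set G) ≤ P) (hPQ : Disjoint P Q) (hu : u ∈ P)
    (hu1 : u ≠ 1) : Q.map (MulAut.conj u).toMonoidHom ⊓ Q = ⊥ := by
  refine (Subgroup.eq_bot_iff_forall _).2 ?_
  rintro _ ⟨⟨w, hw, rfl⟩, hz⟩
  have hcomm : u * w = w * u := commutatorElement_eq_one_iff_mul_comm.1 <|
    Subgroup.disjoint_def.1 hPQ (commutatorElement_mem_of_mem_normal hu w)
      (Q.mul_mem hz (Q.inv_mem hw))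
  have hwC : w ∈ Subgroup.centralizer (P : Set G) := by
    rw [← zpowers_eq_of_isAtom hP hu hu1, Subgroup.mem_centralizer_iff]
    exact Subgroup.forall_mem_zpowers.2 fun n => (Commute.zpow_left hcomm n).eq
  rw [Subgroup.disjoint_def.1 hPQ (hPC hwC) hw, map_one]

lemma sup_map_conj_eq_top [P.Normal] (hP : IsAtom P) (hPQ : P ⊔ Q = ⊤) (hAQ : A ≤ Q)
    (hu : u ∈ P) (hx : x ∈ A) (hux : ⁅u, x⁆ ≠ 1) :
    A ⊔ Q.map (MulAut.conj u).toMonoidHom = ⊤ := by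
  set T := A ⊔ Q.map (MulAut.conj u).toMonoidHom
  have hconj (w : G) (hw : w ∈ Q) : u * w * u⁻¹ ∈ T := Subgroup.mem_sup_right ⟨w, hw, rfl⟩
  have hPT : P ≤ T := by
    rw [← zpowers_eq_of_isAtom hP (commutatorElement_mem_of_mem_normal hu x) hux,
      Subgroup.zpowers_le]
    exact T.mul_mem (hconj x (hAQ hx)) (T.inv_mem (Subgroup.mem_sup_left hx))
  refine top_le_iff.1 (hPQ ▸ sup_le hPT fun w hw => ?_)
  exact (T.mul_mem_cancel_left (hPT hu)).1
    ((T.mul_mem_cancel_right (T.inv_mem (hPT hu))).1 (hconj w hw))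

lemma IsModularSubgroup.eq_of_le_of_isComplement' [P.Normal] (hA : IsModularSubgroup A)
    (hP : IsAtom P) (hPC : Subgroup.centralizer (P : Set G) ≤ P) (hPQ : P.IsComplement' Q)
    (hAQ : A ≤ Q) (hA1 : A ≠ ⊥) : A = Q := by
  obtain ⟨x, hx, hx1⟩ := (Subgroup.bot_or_exists_ne_one A).resolve_left hA1
  obtain ⟨u, hu, hux⟩ : ∃ u ∈ P, ⁅u, x⁆ ≠ 1 := by
    by_contra! h
    refine hx1 (Subgroup.disjoint_def.1 hPQ.disjoint (hPC ?_) (hAQ hx))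
    exact Subgroup.mem_centralizer_iff.2 fun u hu =>
      commutatorElement_eq_one_iff_mul_comm.1 (h u hu)
  have hu1 : u ≠ 1 := fun h => hux (by rw [h, commutatorElement_one_left])
  -- The modular law for `A ≤ Q` and the conjugate `Qᵘ`.
  have hmod := hA.2 (Q.map (MulAut.conj u).toMonoidHom) Q hAQ
  rwa [map_conj_inf_eq_bot hP hPC hPQ.disjoint hu hu1,
    sup_map_conj_eq_top hP hPQ.sup_eq_top hAQ hu hx hux, sup_bot_eq, top_inf_eq] at hmod

lemma IsMSigmaTGroup.index_eq_of_centralizer_le [Finite G] (hG : IsMSigmaTGroup σ G)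
    (hpi : p ∈ σ i) (hsi : s ∈ σ i) (hp : p.Prime) (hs : s.Prime) [P.Normal]
    (hP : Nat.card P = p) (hidx : ¬ p ∣ P.index) (hPC : Subgroup.centralizer (P : Set G) ≤ P)
    (hsP : s ∣ P.index) : P.index = s := by
  have := Fact.mk hs
  have hP_atom : IsAtom P := isAtom_iff_card_prime.2 (hP ▸ hp)
  obtain ⟨Q, hPQ⟩ := Subgroup.exists_right_complement'_of_coprime (N := P)
    (hP ▸ hp.coprime_iff_not_dvd.2 hidx)
  have hindex : P.index = Nat.card Q := hPQ.symm.index_eq_card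
  obtain ⟨⟨h, hQ⟩, hh⟩ := exists_prime_orderOf_dvd_card' s (hindex ▸ hsP)
  have hcard : Nat.card (Subgroup.zpowers h) = s := by
    rw [Nat.card_zpowers, ← hh, Subgroup.orderOf_mk]
  have hnormal (E : Subgroup G) (hE : E ≤ P) : E.Normal := by
    rcases hP_atom.le_iff.1 hE with rfl | rfl <;> infer_instance
  have hsup : (Subgroup.zpowers h ⊔ P).Normal := by
    refine Subgroup.Normal.of_commutator_le G <| le_sup_of_le_right <|
      Subgroup.commutator_le.2 fun g _ k _ => ?_
    exact hPC (commutatorElement_mem_centralizer hnormal g k)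
  have hmod := (hG.isSigmaQuasinormal_of_normal_sup hpi hsi hp hs hP hcard hsup).2
  rw [hindex, ← hcard, hmod.eq_of_le_of_isComplement' hP_atom hPC hPQ (Subgroup.zpowers_le.2 hQ)]
  rintro hbot
  exact hs.ne_one (hcard ▸ Subgroup.card_eq_one.2 hbot)

lemma le_of_residualConditions_quotient [Finite G] (hσ : IsPrimePartition σ) (hp : p.Prime)
    (hs : s.Prime) (hsp : s ≠ p) (hpi : p ∈ σ i) (hsi : s ∈ σ i) [P.Normal] (hP : IsPGroup p P)
    (hx : IsPElement s x) (hα : IsPowerAutomorphism (MulAut.conjNormal x : MulAut P))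
    (hxP : x ∉ Subgroup.centralizer (P : Set G)) (hPD : P ≤ sigmaResidual σ G) (N : Subgroup G)
    [N.Normal] (hN : ResidualConditions σ (sigmaResidual σ (G ⧸ N))) : P ≤ N := by
  intro u hu
  obtain ⟨v, hv, rfl⟩ := exists_commutatorElement_eq hp hs hsp hP hx hα hxP hu
  have hvD : QuotientGroup.mk' N v ∈ sigmaResidual σ (G ⧸ N) :=
    map_sigmaResidual hσ (QuotientGroup.mk'_surjective N) ▸ Subgroup.mem_map_of_mem _ (hPD hv)
  have hcomm := piClosure_le_centralizer_iff.1 (hN.le_centralizer i) s p hs hp hsi hpi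
    (QuotientGroup.mk' N x) trivial (QuotientGroup.mk' N v) hvD (hx.map _)
    ((isPGroup_iff_forall_isPElement.1 hP v hv).map _)
  rwa [← QuotientGroup.ker_mk' N, MonoidHom.mem_ker, map_commutatorElement,
    commutatorElement_eq_one_iff_commute, Commute.symm_iff]

lemma centralizer_le_of_forall_normal_le [Finite G] (hp : p.Prime) [P.Normal] (hP : IsPGroup p P)
    (hidx : ¬ p ∣ P.index) (hP1 : P ≠ ⊥)
    (hle : ∀ N : Subgroup G, N.Normal → N ≠ ⊥ → P ≤ N) :
    Subgroup.centralizer (P : Set G) ≤ P := by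
  set L := piClosure {p}ᶜ (Subgroup.centralizer (P : Set G))
  have hLP : L ⊓ P = ⊥ := disjoint_piClosure hP hp hidx piClosure_le
  have hL : L = ⊥ := by
    by_contra hne
    exact hP1 (by rw [← hLP, inf_eq_right.2 (hle L inferInstance hne)])
  have hsup : Subgroup.centralizer (P : Set G) ≤ L ⊔ P := le_piClosure_sup hp hidx _
  rwa [hL, bot_sup_eq] at hsup

lemma IsMSigmaTGroup.piClosure_le_centralizer [Finite G] (hσ : IsPrimePartition σ)
    (hG : IsMSigmaTGroup σ G) (hp : p.Prime) (ht : t.Prime) (hpi : p ∈ σ i) (hti : t ∉ σ i)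
    [P.Normal] (hP : IsPGroup p P) (hidx : ¬ p ∣ P.index) (hy : IsPElement t y)
    (hyP : y ∉ Subgroup.centralizer (P : Set G))
    (hR : ∀ N : Subgroup G, ∀ _ : N.Normal, N ≠ ⊥ →
      ResidualConditions σ (sigmaResidual σ (G ⧸ N))) :
    piClosure (σ i) (⊤ : Subgroup G) ≤ Subgroup.centralizer (P : Set G) := by
  refine piClosure_le_iff.2 fun s hs hsi x _ hx => by_contra fun hxP => ?_
  have htp : t ≠ p := fun h => hti (h ▸ hpi)
  have hcomm := hG.isMulCommutative hp ht htp hP hy hyP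
  have hdvd {q : ℕ} (hq : q.Prime) {z : G} (hz : IsPElement q z)
      (hzP : z ∉ Subgroup.centralizer (P : Set G)) : q ∣ P.index := by
    by_contra h
    exact hzP (Subgroup.le_centralizer P (hz.mem_of_not_dvd_index hq h))
  have hsp : s ≠ p := fun h => hidx (h ▸ hdvd hs hx hxP)
  have hle (N : Subgroup G) (hN : N.Normal) (hN1 : N ≠ ⊥) : P ≤ N :=
    le_of_residualConditions_quotient hσ hp hs hsp hpi hsi hP hx
      (hG.isPowerAutomorphism_conjNormal hp hs hsp hP hx) hxP
      (hG.le_sigmaResidual hσ hp ht hpi hti hP hy hyP) N (hR N hN hN1)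
  have hP1 : P ≠ ⊥ := by
    rintro rfl
    exact hxP (Subgroup.mem_centralizer_iff.2 fun u hu => by
      rw [Subgroup.mem_bot.1 hu, one_mul, mul_one])
  have hP_atom : IsAtom P := ⟨hP1, fun E hE => by_contra fun hE1 =>
    hE.not_ge (hle E (hG.normal_of_le hp hP hidx hE.le) hE1)⟩
  have hcard : Nat.card P = p := by
    have := Fact.mk hp
    obtain ⟨n, hn⟩ := IsPGroup.iff_card.1 hP
    exact (Nat.prime_dvd_prime_iff_eq (isAtom_iff_card_prime.1 hP_atom) hp).1
      ((isAtom_iff_card_prime.1 hP_atom).dvd_of_dvd_pow hn.dvd)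
  have hindex := hG.index_eq_of_centralizer_le hpi hsi hp hs hcard hidx
    (centralizer_le_of_forall_normal_le hp hP hidx hP1 hle) (hdvd hs hx hxP)
  have hts : t = s := (Nat.prime_dvd_prime_iff_eq ht hs).1 (hindex ▸ hdvd ht hy hyP)
  exact hti (hts ▸ hsi)

end SelfCentralizing

section Structure

variable {ι : Type*} {σ : ι → Set ℕ} {G : Type*} [Group G] {π : Set ℕ} {p : ℕ} {i : ι}
  {A B D M P : Subgroup G}

lemma IsMSigmaTGroup.residualConditions_of_le_centralizer [Finite G] (hσ : IsPrimePartition σ)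
    (hG : IsMSigmaTGroup σ G) (hp : p.Prime) (hpi : p ∈ σ i) [P.Normal] (hP : IsPGroup p P)
    (hidx : ¬ p ∣ P.index)
    (hout : piClosure (σ i)ᶜ (⊤ : Subgroup G) ≤ Subgroup.centralizer (P : Set G))
    (hR : ResidualConditions σ (sigmaResidual σ (G ⧸ P))) :
    ResidualConditions σ (sigmaResidual σ G) := by
  have hDP : sigmaResidual σ G ⊓ P = ⊥ := by
    refine le_bot_iff.1 <| (inf_le_inf_right P <|
      sigmaResidual_le_piClosure hσ hp hpi hP hidx hout).trans
      (disjoint_piClosure hP hp hidx ?_).le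
    refine piClosure_le_iff.2 fun q hq hqp x hxD hx => by_contra fun hxP => hxP ?_
    have := hG.isMulCommutative hp hq hqp hP hx hxP
    exact sigmaResidual_le_centralizer hσ (fun E hE => hG.normal_of_le hp hP hidx hE) hxD
  refine .of_map_mk (isHallSubgroup_of_isPGroup hp hP hidx) hDP ?_
  rwa [map_sigmaResidual hσ (QuotientGroup.mk'_surjective P)]

lemma IsMSigmaTGroup.residualConditions_of_not_mem_centralizer [Finite G]
    (hσ : IsPrimePartition σ) (hG : IsMSigmaTGroup σ G) (hp : p.Prime) (hp2 : p ≠ 2)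
    (hpi : p ∈ σ i) [P.Normal] (hP : IsPGroup p P) (hidx : ¬ p ∣ P.index) (hP1 : P ≠ ⊥)
    {t : ℕ} (ht : t.Prime) (hti : t ∉ σ i) {y : G} (hy : IsPElement t y)
    (hyP : y ∉ Subgroup.centralizer (P : Set G))
    (hR : ∀ N : Subgroup G, ∀ _ : N.Normal, N ≠ ⊥ →
      ResidualConditions σ (sigmaResidual σ (G ⧸ N))) :
    ResidualConditions σ (sigmaResidual σ G) := by
  have hcomm := hG.isMulCommutative hp ht (fun h => hti (h ▸ hpi)) hP hy hyP
  have hn (E : Subgroup G) (hE : E ≤ P) : E.Normal := hG.normal_of_le hp hP hidx hE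
  have hRP : ResidualConditions σ P := residualConditions_of_isPGroup hσ hp hp2 hpi hP hidx hn
    (hG.piClosure_le_centralizer hσ hp ht hpi hti hP hidx hy hyP hR)
  refine .of_map_mk_of_le hp hP hidx (hG.le_sigmaResidual hσ hp ht hpi hti hP hy hyP)
    (sigmaResidual_le_centralizer hσ hn) hRP ?_
  rw [map_sigmaResidual hσ (QuotientGroup.mk'_surjective P)]
  exact hR P inferInstance hP1

theorem IsMSigmaTGroup.residualConditions_sigmaResidual {G : Type*} [Group G] [Finite G]
    [Group.IsSolvable G] (hσ : IsPrimePartition σ) (hG : IsMSigmaTGroup σ G) :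
    ResidualConditions σ (sigmaResidual σ G) := by
  induction hn : Nat.card G using Nat.strong_induction_on generalizing G with
  | _ n ih =>
  subst hn
  cases subsingleton_or_nontrivial G
  · rw [Subsingleton.elim (sigmaResidual σ G) ⊥]
    exact residualConditions_bot
  obtain ⟨p, hp, hpG, hmax⟩ := exists_max_prime_dvd (Finite.one_lt_card (α := G))
  have := Fact.mk hp
  obtain ⟨P⟩ : Nonempty (Sylow p G) := inferInstance
  have hPn : (P : Subgroup G).Normal := hG.sylow_normal_of_max_prime hmax P
  have hP1 : (P : Subgroup G) ≠ ⊥ := P.ne_bot_of_dvd_card hpG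
  have hR (N : Subgroup G) (_ : N.Normal) (hN : N ≠ ⊥) :
      ResidualConditions σ (sigmaResidual σ (G ⧸ N)) :=
    ih _ (card_quotient_lt hN) (hG.of_surjective (QuotientGroup.mk'_surjective N)) rfl
  obtain ⟨i, hpi⟩ := hσ.exists_mem hp
  by_cases hout : piClosure (σ i)ᶜ ⊤ ≤ Subgroup.centralizer ((P : Subgroup G) : Set G)
  · exact hG.residualConditions_of_le_centralizer hσ hp hpi P.isPGroup'
      P.not_dvd_index hout (hR P hPn hP1)
  · simp only [piClosure_le_iff, not_forall] at hout
    obtain ⟨t, ht, hti, y, -, hy, hyP⟩ := hout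
    refine hG.residualConditions_of_not_mem_centralizer hσ hp ?_ hpi P.isPGroup'
      P.not_dvd_index hP1 ht hti hy hyP hR
    have htG : t ∣ Nat.card G := by
      rw [← Subgroup.card_top]
      by_contra h
      exact hyP (hy.eq_one_of_not_dvd_card ht (Subgroup.mem_top y) h ▸ one_mem _)
    have htp : t < p := (hmax t ht htG).lt_of_ne fun h => hti (h ▸ hpi)
    exact (ht.two_le.trans_lt htp).ne'

lemma isHallPiSubgroup_sup_piClosure [Finite G] [D.Normal] (hD : IsHallSubgroup D)
    (hDM : D.IsComplement' M) (hDπ : IsPiGroup π (piClosure π D))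
    (hMπ : IsPiGroup π (piClosure π M)) :
    IsHallPiSubgroup π (piClosure π M ⊔ piClosure π D) := by
  refine ⟨fun q hq hd => ?_, fun q hq hd hqπ => ?_⟩
  · exact (hq.dvd_mul.1 (hd.trans (card_sup_dvd_mul _ _))).elim (hDπ q hq) (hMπ q hq)
  have hqD : ¬ q ∣ Nat.card D := fun hqD =>
    not_dvd_index_of_forall_isPElement hq (fun x hx => Subgroup.mem_sup_right <|
      hx.mem_piClosure hq hqπ (hD.mem_of_dvd_card hq hqD hx)) hd
  have hqM : ¬ q ∣ (piClosure π M).relIndex M :=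
    not_dvd_index_of_forall_isPElement hq fun x hx => Subgroup.mem_subgroupOf.2 <|
      (isPElement_coe.2 hx).mem_piClosure hq hqπ x.2
  have hdvd : q ∣ (piClosure π M).relIndex M * Nat.card D := by
    rw [← hDM.index_eq_card, Subgroup.relIndex_mul_index piClosure_le]
    exact hd.trans (Subgroup.index_dvd_of_le le_sup_left)
  exact (hq.dvd_mul.1 hdvd).elim hqM hqD

lemma hasNormalComplementIn_sup (hAB : A ≤ Subgroup.centralizer (B : Set G))
    (hdisj : Disjoint B A) : HasNormalComplementIn B (A ⊔ B) := by
  have hnormal : (A.subgroupOf (A ⊔ B)).Normal :=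
    (Subgroup.normal_subgroupOf_iff_le_normalizer le_sup_left).2 <| sup_le Subgroup.le_normalizer <|
      (Subgroup.le_centralizer_iff.1 hAB).trans (Subgroup.centralizer_le_normalizer _)
  refine ⟨le_sup_right, A.subgroupOf (A ⊔ B), hnormal,
    Subgroup.isComplement'_of_disjoint_and_mul_eq_univ ?_ ?_⟩
  · exact Subgroup.disjoint_def.2 fun hB hA => Subtype.ext (Subgroup.disjoint_def.1 hdisj hB hA)
  · rw [← Subgroup.mul_normal, sup_comm (B.subgroupOf _),
      (Subgroup.codisjoint_subgroupOf_sup A B).eq_top, Subgroup.coe_top]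

lemma ResidualConditions.exists_isHallPiSubgroup [Finite G] (hD : ResidualConditions σ D)
    (hDM : D.IsComplement' M) (hM : SigmaCommuting σ M) (i : ι) :
    ∃ H : Subgroup G, IsHallPiSubgroup (σ i) H ∧
      HasNormalComplementIn ((piCore (σ i) D).map D.subtype) H := by
  have := hD.comm
  have hDn : D.Normal := hD.normal_of_le D le_rfl
  have hDπ : IsPiGroup (σ i) (piClosure (σ i) D) := isPiGroup_piClosure <| piClosure_le.trans <|
    (Subgroup.le_centralizer D).trans (Subgroup.centralizer_le piClosure_le)
  have hMπ : IsPiGroup (σ i) (piClosure (σ i) M) := isPiGroup_piClosure <|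
    piClosure_le_centralizer_iff.2 fun p q hp hq hpi hqi x hx y hy hxp hyq =>
      (hM i p q hp hq hpi hqi ⟨x, hx⟩ ⟨y, hy⟩ (isPElement_coe.1 hxp)
        (isPElement_coe.1 hyq)).map M.subtype
  rw [map_subtype_piCore]
  refine ⟨_, isHallPiSubgroup_sup_piClosure hD.hall hDM hDπ hMπ,
    hasNormalComplementIn_sup ?_ (hDM.disjoint.mono piClosure_le piClosure_le)⟩
  exact (piClosure_mono subset_rfl le_top).trans (hD.le_centralizer i)

theorem IsMSigmaTGroup.isModularLattice_of_isSigmaNilpotent [Finite G] [Group.IsSolvable G]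
    (hσ : IsPrimePartition σ) (hG : IsMSigmaTGroup σ G) (hnil : IsSigmaNilpotent σ G) :
    IsModularLattice (Subgroup G) := by
  have hcomm := hnil.sigmaCommuting hσ
  refine ModularTransitive.isModularLattice fun K H hH hK => ?_
  exact (hG K H ⟨(hcomm.of_injective K.subtype_injective).isSigmaSubnormal hσ H, hH⟩
    ⟨hcomm.isSigmaSubnormal hσ K, hK⟩).2

theorem IsMSigmaTGroup.exists_structureConditions [Finite G] [Group.IsSolvable G]
    (hσ : IsPrimePartition σ) (hG : IsMSigmaTGroup σ G) :
    ∃ M : Subgroup G, StructureConditions σ (sigmaResidual σ G) M := by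
  have hD := hG.residualConditions_sigmaResidual hσ
  obtain ⟨M, hM⟩ := Subgroup.exists_right_complement'_of_coprime hD.hall
  set f := (QuotientGroup.mk' (sigmaResidual σ G)).comp M.subtype
  have hf : Function.Injective f := by
    refine (injective_iff_map_eq_one f).2 fun m hm => Subtype.ext ?_
    exact Subgroup.disjoint_def.1 hM.disjoint ((QuotientGroup.eq_one_iff (m : G)).1 hm) m.2
  have hnil := isSigmaNilpotent_quotient_sigmaResidual (G := G) hσ
  have hMσ : SigmaCommuting σ M := (hnil.sigmaCommuting hσ).of_injective hf
  have hmod := (hG.of_surjective (QuotientGroup.mk'_surjective (sigmaResidual σ G)))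
    |>.isModularLattice_of_isSigmaNilpotent hσ hnil
  exact ⟨M, {
    normal := inferInstance
    compl := hM
    abelian := hD.comm
    hall := hD.hall
    odd := hD.odd
    nilpotent := hMσ.isSigmaNilpotent hσ
    modular := isModularLattice_of_injective hmod hf
    power := fun g => SigmaGroup.isPowerAutomorphism_conjNormal fun A hA =>
      (Subgroup.normalizer_eq_top_iff.2 (hD.normal_of_le A hA)) ▸ Subgroup.mem_top g
    complement := hD.exists_isHallPiSubgroup hM hMσ }⟩

end Structure

end SigmaGroup

theorem theorem4p5 {G : Type*} [Group G] [Finite G] {ι : Type*} (σ : ι → Set ℕ)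
    (hσ : SigmaGroup.IsPrimePartition σ) :
    (Group.IsSolvable G → SigmaGroup.IsMSigmaTGroup σ G →
      ∃ M : Subgroup G, SigmaGroup.StructureConditions σ (SigmaGroup.sigmaResidual σ G) M) ∧
    (∀ D M : Subgroup G, SigmaGroup.StructureConditions σ D M →
      Group.IsSolvable G ∧ SigmaGroup.IsMSigmaTGroup σ G) :=
  ⟨fun _ hG => hG.exists_structureConditions hσ, fun _ _ S => ⟨S.isSolvable, S.isMSigmaTGroup⟩⟩
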